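/- **Theorem 1.** Let $m\ge 1$ and $\tau\ge 1$ be integers, $0<\alpha<1$, $L>0$, $\sigma,\kappa\in\mathbb{R}$. Let $\mathcal D_1,\dots,\mathcal D_m$ be probability distributions of data, $\ell(\cdot\,;\cdot)$ a loss with $\ell(x;\cdot)$ integrable under every $\mathcal D_i$, $F_i(x)=\mathbb E_{s\sim\mathcal D_i}[\ell(x;s)]$ and $F(x)=\frac1m\sum_{i=1}^m F_i(x)$ for $x\in\mathbb R^d$, and let $F_{\inf}\in\mathbb R$ satisfy $F_{\inf}\le F(x)$ for all $x$. Let $g_i(x;\xi)\in\mathbb R^d$ be stochastic gradients. Assume, for all $i$, $x$, $y$: 1. $F_i$ is differentiable and $\|\nabla F_i(x)-\nabla F_i(y)\|\le L\|x-y\|$; 2. $\mathbb E_{\xi\sim\mathcal D_i}[g_i(x;\xi)]=\nabla F_i(x)$; 3. $\mathbb E_{\xi\sim\mathcal D_i}\big[\|g_i(x;\xi)-\nabla F_i(x)\|^2\big]\le\sigma^2$; 4. $\frac1m\sum_{i=1}^m\|\nabla F_i(x)-\nabla F(x)\|^2\le\kappa^2$. Let $\xi_k^{(i)}\sim\mathcal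 D_i$ ($k\ge 0$, $1\le i\le m$) be independent samples. Overlap-Local-SGD with learning rate $\eta$ starts all local models and the anchor at one point, $x_0^{(1)}=\dots=x_0^{(m)}=z_0$, and iterates, for $k\ge 0$, $$x^{(i)}_{k+\frac12}=x^{(i)}_k-\eta\, g_i(x^{(i)}_k;\xi^{(i)}_k),$$ $$x^{(i)}_{k+1}=\begin{cases}x^{(i)}_{k+\frac12}-\alpha\,(x^{(i)}_{k+\frac12}-z_k)&\text{if }\tau\mid k+1,\\ x^{(i)}_{k+\frac12}&\text{otherwise,}\end{cases}\qquad z_{k+1}=\begin{cases}\frac1m\sum_{i=1}^m x^{(i)}_{k+1}&\text{if }\tau\mid k+1,\\ z_k&\text{otherwise.}\end{cases}$$ Put $y_k=(1-\alpha)\frac1m\sum_{i=1}^m x^{(i)}_k+\alpha z_k$. Let $K$ be an integer with $K\ge 60m\tau^2/\alpha^2$, and let $\eta=\frac1L\sqrt{m/K}$. Then $$y_{k+1}=y_k-(1-\alpha)\eta\,\frac1m\sum_{i=1}^m g_i(x^{(i)}_k;\xi^{(i)}_k)\qquad(k\ge 0),$$ all the expectations $\mathbb E\|\nabla F(y_k)\|^2$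 are finite, and $$\frac1K\sum_{k=0}^{K-1}\mathbb E\big[\|\nabla F(y_k)\|^2\big]\le\frac{4L\,[F(y_0)-F_{\inf}]}{(1-\alpha)\sqrt{mK}}+\frac{2(1-\alpha)\sigma^2}{\sqrt{mK}}+\frac{2m\sigma^2}{K}\Big[\frac{2\tau}{(2-\alpha)\alpha}-1\Big]+\frac{2m\tau^2\kappa^2}{\alpha^2K}.$$ For fixed $L$, $F(y_0)-F_{\inf}$, $\sigma$, $\kappa$, $\alpha$, $\tau$, the right-hand side is at most $C_1/\sqrt{mK}+C_2\,m/K$ for all $m,K\ge1$, with $C_1,C_2$ independent of $m$ and $K$; in particular, for fixed $m$, it is $O(1/\sqrt{mK})+O(1/K)$. -/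

import Mathlib

open MeasureTheory ProbabilityTheory

namespace OverlapLocalSGD

noncomputable section

/-- The local objective `F_i(x) = E_{s ∼ D_i}[ℓ(x; s)]`. -/
def localObjective {d m : ℕ} {S : Type*} [MeasurableSpace S]
    (ℓ : EuclideanSpace ℝ (Fin d) → S → ℝ) (D : Fin m → Measure S) (i : Fin m)
    (x : EuclideanSpace ℝ (Fin d)) : ℝ :=
  ∫ s, ℓ x s ∂(D i)

/-- The global objective `F(x) = (1/m) ∑ i, F_i(x)`. -/
def objective {d m : ℕ} {S : Type*} [MeasurableSpace S]
    (ℓ : EuclideanSpace ℝ (Fin d) → S → ℝ) (D : Fin m → Measure S)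
    (x : EuclideanSpace ℝ (Fin d)) : ℝ :=
  (1 / (m : ℝ)) * ∑ i, localObjective ℓ D i x

/-- The models held at a given iteration: the local models `x^(1), …, x^(m)` and the anchor `z`. -/
structure State (d m : ℕ) where
  x : Fin m → EuclideanSpace ℝ (Fin d)
  z : EuclideanSpace ℝ (Fin d)

/-- All local models and the anchor start at the same point. -/
def initialState {d : ℕ} (m : ℕ) (x₀ : EuclideanSpace ℝ (Fin d)) : State d m where
  x := fun _ => x₀
  z := x₀

/-- The stochastic gradient step `x^(i)_{k+1/2} = x^(i)_k - η g_i(x^(i)_k; ξ^(i)_k)`. -/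
def halfStep {d m : ℕ} {S : Type*}
    (g : Fin m → EuclideanSpace ℝ (Fin d) → S → EuclideanSpace ℝ (Fin d)) (η : ℝ)
    (ξ : Fin m → S) (s : State d m) (i : Fin m) : EuclideanSpace ℝ (Fin d) :=
  s.x i - η • g i (s.x i) (ξ i)

/-- The new local models: pulled back towards the old anchor iff `τ` divides `k + 1`. -/
def nextLocal {d m : ℕ} {S : Type*}
    (g : Fin m → EuclideanSpace ℝ (Fin d) → S → EuclideanSpace ℝ (Fin d)) (η α : ℝ) (τ k : ℕ)
    (ξ : Fin m → S) (s : State d m) (i : Fin m) : EuclideanSpace ℝ (Fin d) :=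
  if (k + 1) % τ = 0 then
    halfStep g η ξ s i - α • (halfStep g η ξ s i - s.z)
  else
    halfStep g η ξ s i

/-- Iteration `k` of Overlap-Local-SGD; the anchor becomes the average of the new local models
iff `τ` divides `k + 1`. -/
def step {d m : ℕ} {S : Type*}
    (g : Fin m → EuclideanSpace ℝ (Fin d) → S → EuclideanSpace ℝ (Fin d)) (η α : ℝ) (τ k : ℕ)
    (ξ : Fin m → S) (s : State d m) : State d m where
  x := nextLocal g η α τ k ξ s
  z := if (k + 1) % τ = 0 then (1 / (m : ℝ)) • ∑ i, nextLocal g η α τ k ξ s i else s.z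

/-- The state after `k` iterations, when iteration `j` uses the samples `ξ j`. -/
def iterate {d m : ℕ} {S : Type*}
    (g : Fin m → EuclideanSpace ℝ (Fin d) → S → EuclideanSpace ℝ (Fin d)) (η α : ℝ) (τ : ℕ)
    (x₀ : EuclideanSpace ℝ (Fin d)) (ξ : ℕ → Fin m → S) : ℕ → State d m
  | 0 => initialState m x₀
  | k + 1 => step g η α τ k (ξ k) (iterate g η α τ x₀ ξ k)

/-- The virtual averaged model `y = (1 - α) (1/m) ∑ i, x^(i) + α z`. -/
def virtualModel {d m : ℕ} (α : ℝ) (s : State d m) : EuclideanSpace ℝ (Fin d) :=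
  (1 - α) • ((1 / (m : ℝ)) • ∑ i, s.x i) + α • s.z

/-- The learning rate `η = (1/L) √(m/K)`. -/
def learningRate (L : ℝ) (m K : ℕ) : ℝ :=
  (1 / L) * Real.sqrt ((m : ℝ) / (K : ℝ))

/-- The explicit four-term bound, where `Δ` stands for `F(y_0) - F_inf`. -/
def errorBound (L Δ σ κ α : ℝ) (τ m K : ℕ) : ℝ :=
  4 * L * Δ / ((1 - α) * Real.sqrt ((m : ℝ) * (K : ℝ)))
    + 2 * (1 - α) * σ ^ 2 / Real.sqrt ((m : ℝ) * (K : ℝ))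
    + 2 * (m : ℝ) * σ ^ 2 / (K : ℝ) * (2 / ((2 - α) * α) * (τ : ℝ) - 1)
    + 2 * (m : ℝ) * (τ : ℝ) ^ 2 * κ ^ 2 / (α ^ 2 * (K : ℝ))

end

end OverlapLocalSGD

namespace OverlapLocalSGD

noncomputable section

/-! The virtual model `y` runs plain SGD with step `(1 - α) η`, so the descent lemma applies to it.
The only defect is that the averaged field `h k`, the mean of the `f i` at the local models, is not
the gradient of `F` at `y k`. By smoothness this gap is at most `L ^ 2` times the mean squared
distance of the local models from `y k`, which splits into the dispersion about their average and
`α` times the distance from average to anchor. Both solve the same linear recursion: add a term,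
then multiply by `1 - α` (dispersion) or by `0` (anchor gap) once per period. Hence both are a
`dampedSum` of gradients (`local_sub_mean`, `mean_sub_anchor`).

The gradients are split into a noise part and field parts. For the field parts a Young inequality
(`sum_norm_dampedSum_sq_le`) holds along every path with constant `(τ / α) ^ 2`; since `η ^ 2 * L ^
2 * (τ / α) ^ 2 ≤ 1 / 60`, the parts that depend on the trajectory are absorbed, into the dispersion
itself or into the term `-‖h k‖ ^ 2 / 2` left by the descent lemma, and only the dissimilarity `κ`
survives. This gives a pathwise inequality (`sum_norm_gradient_sq_le`) with the noise still
explicit.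

Expectations enter only then. Noises at distinct (iteration, worker) pairs are orthogonal in `L²`,
so the second moments of their damped sums follow from Pythagoras
(`sum_norm_dampedSum_orthogonal_le`), linear in `τ` where Young would give `τ ^ 2`. The term linear
in the current noise has mean zero because its other factor depends on earlier samples only. -/

/-! ### Averages -/

section Average

variable {E : Type*} [NormedAddCommGroup E] [InnerProductSpace ℝ E] {m : ℕ}

/-- The arithmetic mean of a finite family of vectors. -/
def mean (a : Fin m → E) : E := (1 / (m : ℝ)) • ∑ i, a i

lemma natCast_smul_mean (hm : 0 < m) (a : Fin m → E) : (m : ℝ) • mean a = ∑ i, a i := by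
  have : (m : ℝ) ≠ 0 := by positivity
  rw [mean, smul_smul, mul_one_div_cancel this, one_smul]

lemma mean_add (a b : Fin m → E) : mean (fun i => a i + b i) = mean a + mean b := by
  simp [mean, Finset.sum_add_distrib]

lemma mean_sub (a b : Fin m → E) : mean (fun i => a i - b i) = mean a - mean b := by
  simp [mean, Finset.sum_sub_distrib, smul_sub]

lemma mean_smul (c : ℝ) (a : Fin m → E) : mean (fun i => c • a i) = c • mean a := by
  simp only [mean, ← Finset.smul_sum, smul_comm c]

lemma mean_const (hm : 0 < m) (c : E) : mean (fun _ : Fin m => c) = c := by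
  have : (m : ℝ) ≠ 0 := by positivity
  simp [mean, ← Nat.cast_smul_eq_nsmul ℝ, smul_smul, this]

/-- Parallel axis identity: deviations from the mean sum to zero, so the cross term vanishes. With
`c = 0` it is the variance formula; with `c = y` it separates dispersion from the displacement of
the average. -/
lemma sum_norm_sub_sq (hm : 0 < m) (a : Fin m → E) (c : E) :
    ∑ i, ‖a i - c‖ ^ 2 = ∑ i, ‖a i - mean a‖ ^ 2 + m * ‖mean a - c‖ ^ 2 := by
  have h : ∀ i, ‖a i - c‖ ^ 2 = ‖a i - mean a‖ ^ 2 + 2 * inner ℝ (a i - mean a) (mean a - c)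
      + ‖mean a - c‖ ^ 2 := fun i => by
    rw [← norm_add_sq_real]; congr 2; abel
  have h0 : ∑ i, (a i - mean a) = 0 := by
    rw [Finset.sum_sub_distrib, ← natCast_smul_mean hm]
    simp [← Nat.cast_smul_eq_nsmul ℝ]
  simp only [h, Finset.sum_add_distrib, ← Finset.mul_sum, ← sum_inner, h0, inner_zero_left]
  simp

lemma sum_norm_sub_mean_sq (hm : 0 < m) (a : Fin m → E) :
    ∑ i, ‖a i - mean a‖ ^ 2 = ∑ i, ‖a i‖ ^ 2 - m * ‖mean a‖ ^ 2 := by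
  have := sum_norm_sub_sq hm a 0
  simp only [sub_zero] at this
  linarith

lemma natCast_mul_norm_mean_sq_le (hm : 0 < m) (a : Fin m → E) :
    m * ‖mean a‖ ^ 2 ≤ ∑ i, ‖a i‖ ^ 2 := by
  have := sum_norm_sub_mean_sq hm a
  have h : 0 ≤ ∑ i, ‖a i - mean a‖ ^ 2 := by positivity
  linarith

end Average

/-- Cauchy–Schwarz with free weights, which are tuned later to reach the constants of the dispersion
bound. -/
lemma norm_add_add_sq_le {E : Type*} [NormedAddCommGroup E] (a b c : E) {p q r : ℝ}
    (hp : 0 < p) (hq : 0 < q) (hr : 0 < r) (h : p + q + r = 1) :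
    ‖a + b + c‖ ^ 2 ≤ ‖a‖ ^ 2 / p + ‖b‖ ^ 2 / q + ‖c‖ ^ 2 / r := by
  have h1 : ‖a + b + c‖ ≤ ‖a‖ + ‖b‖ + ‖c‖ := norm_add₃_le
  calc ‖a + b + c‖ ^ 2 ≤ (‖a‖ + ‖b‖ + ‖c‖) ^ 2 := by gcongr
    _ ≤ _ := by
      have := Finset.sq_sum_div_le_sum_sq_div (R := ℝ) Finset.univ ![‖a‖, ‖b‖, ‖c‖]
        (g := ![p, q, r]) (by intro i _; fin_cases i <;> simpa)
      simpa [Fin.sum_univ_three, h] using this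

/-! ### Periodically damped sums -/

section Damped

variable {E : Type*} [NormedAddCommGroup E] [NormedSpace ℝ E]

/-- The factor `1 - α` at the synchronization steps, and `1` at all others. -/
def damping (α : ℝ) (τ k : ℕ) : ℝ := if (k + 1) % τ = 0 then 1 - α else 1

/-- The accumulated sum of `p` that is multiplied by `damping α τ k` after step `k`. -/
def dampedSum (α : ℝ) (τ : ℕ) (p : ℕ → E) : ℕ → E
  | 0 => 0
  | k + 1 => damping α τ k • (dampedSum α τ p k + p k)

lemma dampedSum_add (α : ℝ) (τ : ℕ) (p q : ℕ → E) (k : ℕ) :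
    dampedSum α τ (fun j => p j + q j) k = dampedSum α τ p k + dampedSum α τ q k := by
  induction k with
  | zero => simp [dampedSum]
  | succ k ih => simp only [dampedSum, ih, ← smul_add]; congr 1; abel

lemma damping_nonneg {α : ℝ} (hα₁ : α ≤ 1) (τ k : ℕ) : 0 ≤ damping α τ k := by
  unfold damping; split_ifs <;> linarith

lemma damping_le_one {α : ℝ} (hα₀ : 0 ≤ α) (τ k : ℕ) : damping α τ k ≤ 1 := by
  unfold damping; split_ifs <;> linarith

/-- A function of the position in the period either is reset or moves on by one. -/
lemma damping_cases (α : ℝ) {τ : ℕ} (hτ : 0 < τ) (k : ℕ) :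
    (damping α τ k = 1 - α ∧ ((k % τ : ℕ) : ℝ) = τ - 1 ∧ (((k + 1) % τ : ℕ) : ℝ) = 0) ∨
    (damping α τ k = 1 ∧ (((k + 1) % τ : ℕ) : ℝ) = (k % τ : ℕ) + 1) := by
  unfold damping
  have hlt := Nat.mod_lt k hτ
  have hmod : (k + 1) % τ = (k % τ + 1) % τ := by simp [Nat.add_mod]
  rcases Nat.lt_or_ge (k % τ + 1) τ with h | h
  · right
    rw [Nat.mod_eq_of_lt h] at hmod
    rw [if_neg (by omega), hmod]
    exact ⟨rfl, by push_cast; ring⟩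
  · left
    have he : k % τ + 1 = τ := by omega
    rw [he, Nat.mod_self] at hmod
    rw [if_pos hmod, hmod]
    refine ⟨rfl, ?_, by simp⟩
    have : ((k % τ : ℕ) : ℝ) + 1 = τ := by exact_mod_cast he
    linarith

/-- A quadratic majorant of `dampedSum`, and the total mass of the weights. -/
lemma norm_dampedSum_sq_le {α : ℝ} (hα₀ : 0 < α) (hα₁ : α ≤ 1) {τ : ℕ} (hτ : 0 < τ)
    (p : ℕ → E) (k : ℕ) :
    ‖dampedSum α τ p k‖ ^ 2 ≤
      (τ * (1 - α) / α + (k % τ : ℕ)) * dampedSum α τ (fun j => ‖p j‖ ^ 2) k ∧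
    0 ≤ dampedSum α τ (fun j => ‖p j‖ ^ 2) k := by
  induction k with
  | zero => simp [dampedSum]
  | succ k ih =>
    obtain ⟨ih, hQ⟩ := ih
    simp only [dampedSum, norm_smul, smul_eq_mul]
    have hρ := damping_nonneg hα₁ τ k
    set ρ := damping α τ k with hρdef
    set r := dampedSum α τ p k
    set Q := dampedSum α τ (fun j => ‖p j‖ ^ 2) k
    set W : ℝ := τ * (1 - α) / α + (k % τ : ℕ) with hW
    have hW0 : 0 ≤ W := by
      have : 0 ≤ 1 - α := by linarith
      positivity
    refine ⟨?_, by positivity⟩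
    -- `W` is the weight mass that an infinite past would have accumulated: the periodic solution of
    -- `W ↦ ρ * (W + 1)`. The bound is then Cauchy–Schwarz with respect to these weights.
    have hW' : (τ : ℝ) * (1 - α) / α + ((k + 1) % τ : ℕ) = ρ * (W + 1) := by
      rcases damping_cases α hτ k with ⟨h1, h2, h3⟩ | ⟨h1, h2⟩
      · rw [hW, h3, h2, hρdef, h1]; field_simp; ring
      · rw [hW, h2, hρdef, h1]; ring
    rw [hW', Real.norm_of_nonneg hρ]
    have hcs : ‖r + p k‖ ^ 2 ≤ (W + 1) * (Q + ‖p k‖ ^ 2) := by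
      have h1 : ‖r + p k‖ ≤ ‖r‖ + ‖p k‖ := norm_add_le _ _
      have h2 : ‖r + p k‖ ^ 2 ≤ (‖r‖ + ‖p k‖) ^ 2 := by gcongr
      have h3 : 2 * (‖r‖ * ‖p k‖) ≤ W * ‖p k‖ ^ 2 + Q := by
        refine abs_le_of_sq_le_sq' ?_ (by positivity) |>.2
        have h4 : ‖r‖ ^ 2 * ‖p k‖ ^ 2 ≤ W * Q * ‖p k‖ ^ 2 := by gcongr
        nlinarith [sq_nonneg (W * ‖p k‖ ^ 2 - Q)]
      nlinarith
    calc (ρ * ‖r + p k‖) ^ 2 = ρ ^ 2 * ‖r + p k‖ ^ 2 := by ring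
      _ ≤ ρ ^ 2 * ((W + 1) * (Q + ‖p k‖ ^ 2)) := by gcongr
      _ = _ := by ring

/-- Exchange of summation, written as a potential argument. A unit present at time `K` contributes
`τ - K % τ` until the next synchronization, then `τ (1 - α)`, `τ (1 - α) ^ 2`, and so on: in total
`τ / α - K % τ`. The second summand on the left is this future contribution. -/
lemma sum_dampedSum_le {α : ℝ} (hα₀ : 0 < α) (hα₁ : α ≤ 1) {τ : ℕ} (hτ : 0 < τ)
    (a : ℕ → ℝ) (ha : ∀ k, 0 ≤ a k) (K : ℕ) :
    ∑ k ∈ Finset.range K, dampedSum α τ a k + (τ / α - (K % τ : ℕ)) * dampedSum α τ a K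
      ≤ τ / α * ∑ k ∈ Finset.range K, a k := by
  induction K with
  | zero => simp [dampedSum]
  | succ k ih =>
    rw [Finset.sum_range_succ, Finset.sum_range_succ]
    have hρ := damping_nonneg hα₁ τ k
    have hρ' := damping_le_one hα₀.le τ k
    simp only [dampedSum, smul_eq_mul]
    set Q := dampedSum α τ a k
    have key : (τ / α - ((k + 1) % τ : ℕ)) * damping α τ k = τ / α - (k % τ : ℕ) - 1 := by
      rcases damping_cases α hτ k with ⟨h1, h2, h3⟩ | ⟨h1, h2⟩
      · rw [h3, h2, h1]; field_simp; ring
      · rw [h2, h1]; ring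
    have : (τ / α - ((k + 1) % τ : ℕ)) * (damping α τ k * (Q + a k))
        = (τ / α - (k % τ : ℕ) - 1) * (Q + a k) := by rw [← key]; ring
    rw [this]
    have h5 : 0 ≤ ((k % τ : ℕ) + 1 : ℝ) * a k := by have := ha k; positivity
    linarith

/-- Young's convolution inequality for periodically damped sums. -/
lemma sum_norm_dampedSum_sq_le {α : ℝ} (hα₀ : 0 < α) (hα₁ : α ≤ 1) {τ : ℕ} (hτ : 0 < τ)
    (p : ℕ → E) (K : ℕ) :
    ∑ k ∈ Finset.range K, ‖dampedSum α τ p k‖ ^ 2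
      ≤ (τ / α) ^ 2 * ∑ k ∈ Finset.range K, ‖p k‖ ^ 2 := by
  have hmod : ∀ k : ℕ, ((k % τ : ℕ) : ℝ) ≤ τ := fun k => by
    exact_mod_cast (Nat.mod_lt k hτ).le
  have hτα : (τ : ℝ) ≤ τ / α := by
    rw [le_div_iff₀ hα₀]; exact mul_le_of_le_one_right (by positivity) hα₁
  have h1 : ∀ k, ‖dampedSum α τ p k‖ ^ 2 ≤ τ / α * dampedSum α τ (fun j => ‖p j‖ ^ 2) k := by
    intro k
    obtain ⟨h, hQ⟩ := norm_dampedSum_sq_le hα₀ hα₁ hτ p k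
    refine h.trans (mul_le_mul_of_nonneg_right ?_ hQ)
    have : (τ : ℝ) * (1 - α) / α = τ / α - τ := by field_simp
    rw [this]; linarith [hmod k]
  have h2 := sum_dampedSum_le hα₀ hα₁ hτ (fun j => ‖p j‖ ^ 2) (fun _ => by positivity) K
  have h3 := (norm_dampedSum_sq_le hα₀ hα₁ hτ p K).2
  have h4 : 0 ≤ (τ / α - (K % τ : ℕ)) * dampedSum α τ (fun j => ‖p j‖ ^ 2) K :=
    mul_nonneg (by linarith [hmod K]) h3
  calc ∑ k ∈ Finset.range K, ‖dampedSum α τ p k‖ ^ 2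
      ≤ ∑ k ∈ Finset.range K, τ / α * dampedSum α τ (fun j => ‖p j‖ ^ 2) k :=
        Finset.sum_le_sum fun k _ => h1 k
    _ = τ / α * ∑ k ∈ Finset.range K, dampedSum α τ (fun j => ‖p j‖ ^ 2) k := by
        rw [Finset.mul_sum]
    _ ≤ τ / α * (τ / α * ∑ k ∈ Finset.range K, ‖p k‖ ^ 2) := by gcongr; linarith
    _ = _ := by ring

end Damped

/-! ### Smooth functions -/

section Smooth

variable {E : Type*} [NormedAddCommGroup E] [InnerProductSpace ℝ E] [CompleteSpace E]

/-- The descent lemma. -/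
lemma le_add_inner_gradient_add_sq {f : E → ℝ} {L : ℝ} (hf : Differentiable ℝ f)
    (hL : ∀ x y, ‖gradient f x - gradient f y‖ ≤ L * ‖x - y‖) (x v : E) :
    f (x + v) ≤ f x + inner ℝ (gradient f x) v + L / 2 * ‖v‖ ^ 2 := by
  -- `f` along the segment minus its quadratic majorant, up to a constant; the Lipschitz bound makes
  -- the derivative nonpositive on the unit interval.
  let ψ : ℝ → ℝ := fun t =>
    f (x + t • v) - (t * inner ℝ (gradient f x) v + L / 2 * ‖v‖ ^ 2 * t ^ 2)
  have hψ : ∀ t, HasDerivAt ψ (inner ℝ (gradient f (x + t • v)) v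
      - (inner ℝ (gradient f x) v + L / 2 * ‖v‖ ^ 2 * (2 * t))) t := by
    intro t
    have h1 : HasDerivAt (fun t : ℝ => x + t • v) v t := by
      simpa using ((hasDerivAt_id t).smul_const v).const_add x
    have h2 := ((hf (x + t • v)).hasGradientAt.hasFDerivAt).comp_hasDerivAt t h1
    have h3 : HasDerivAt (fun t : ℝ => t * inner ℝ (gradient f x) v + L / 2 * ‖v‖ ^ 2 * t ^ 2)
        (inner ℝ (gradient f x) v + L / 2 * ‖v‖ ^ 2 * (2 * t)) t := by
      have := ((hasDerivAt_id t).mul_const (inner ℝ (gradient f x) v)).add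
        ((hasDerivAt_pow 2 t).const_mul (L / 2 * ‖v‖ ^ 2))
      refine (this.congr_deriv ?_)
      simp
    refine HasDerivAt.sub (h2.congr_deriv ?_) h3
    simp
  have hanti : AntitoneOn ψ (Set.Icc 0 1) := by
    refine antitoneOn_of_deriv_nonpos (convex_Icc 0 1)
      (fun t _ => (hψ t).continuousAt.continuousWithinAt)
      (fun t _ => (hψ t).differentiableAt.differentiableWithinAt) fun t ht => ?_
    rw [interior_Icc] at ht
    rw [(hψ t).deriv]
    have h1 : inner ℝ (gradient f (x + t • v) - gradient f x) v
        ≤ L * ‖(x + t • v) - x‖ * ‖v‖ :=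
      (real_inner_le_norm _ _).trans (by gcongr; exact hL _ _)
    rw [inner_sub_left, add_sub_cancel_left, norm_smul, Real.norm_of_nonneg ht.1.le] at h1
    nlinarith
  have := hanti (by simp) (by simp) (zero_le_one (α := ℝ))
  simp only [ψ] at this
  rw [one_smul, zero_smul, add_zero] at this
  linarith

end Smooth

/-! ### The iteration, pathwise -/

section Iteration

variable {d m : ℕ} {S : Type*}
  (g : Fin m → EuclideanSpace ℝ (Fin d) → S → EuclideanSpace ℝ (Fin d)) (η α : ℝ) (τ : ℕ)
  (x₀ : EuclideanSpace ℝ (Fin d)) (ξ : ℕ → Fin m → S)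

/-- The stochastic gradient that worker `i` uses in iteration `k`. -/
def sampledGradient (k : ℕ) (i : Fin m) : EuclideanSpace ℝ (Fin d) :=
  g i ((iterate g η α τ x₀ ξ k).x i) (ξ k i)

/-- One affine formula for both branches of the update: the pull-back is a convex combination with
the anchor. -/
lemma nextLocal_eq (k : ℕ) (i : Fin m) :
    (iterate g η α τ x₀ ξ (k + 1)).x i
      = damping α τ k • ((iterate g η α τ x₀ ξ k).x i - η • sampledGradient g η α τ x₀ ξ k i)
        + (1 - damping α τ k) • (iterate g η α τ x₀ ξ k).z := by
  simp only [iterate, step, nextLocal, damping, halfStep, sampledGradient]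
  split_ifs
  · module
  · simp

lemma mean_nextLocal (hm : 0 < m) (k : ℕ) :
    mean (iterate g η α τ x₀ ξ (k + 1)).x
      = damping α τ k • (mean (iterate g η α τ x₀ ξ k).x
          - η • mean (sampledGradient g η α τ x₀ ξ k))
        + (1 - damping α τ k) • (iterate g η α τ x₀ ξ k).z := by
  have : (iterate g η α τ x₀ ξ (k + 1)).x = fun i => damping α τ k •
      ((iterate g η α τ x₀ ξ k).x i - η • sampledGradient g η α τ x₀ ξ k i)
        + (1 - damping α τ k) • (iterate g η α τ x₀ ξ k).z :=
    funext (nextLocal_eq g η α τ x₀ ξ k)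
  rw [this, mean_add, mean_const hm, mean_smul, mean_sub, mean_smul]

lemma anchor_succ (k : ℕ) :
    (iterate g η α τ x₀ ξ (k + 1)).z = if (k + 1) % τ = 0 then
      mean (iterate g η α τ x₀ ξ (k + 1)).x else (iterate g η α τ x₀ ξ k).z := rfl

lemma virtualModel_eq (s : State d m) :
    virtualModel α s = (1 - α) • mean s.x + α • s.z := rfl

/-- At a synchronization the new anchor equals the new average, so `y` becomes that average, which
is already the `(1 - α, α)` combination of the stepped average and the old anchor. Between
synchronizations the anchor is fixed. -/
lemma virtualModel_succ (hm : 0 < m) (k : ℕ) :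
    virtualModel α (iterate g η α τ x₀ ξ (k + 1)) = virtualModel α (iterate g η α τ x₀ ξ k)
      - ((1 - α) * η) • mean (sampledGradient g η α τ x₀ ξ k) := by
  rw [virtualModel_eq, virtualModel_eq, anchor_succ, mean_nextLocal g η α τ x₀ ξ hm, damping]
  split_ifs <;> module

/-- The anchor is common to all workers, so it cancels in the deviations from the mean. -/
lemma local_sub_mean (hm : 0 < m) (k : ℕ) (i : Fin m) :
    (iterate g η α τ x₀ ξ k).x i - mean (iterate g η α τ x₀ ξ k).x
      = -η • dampedSum α τ (fun j => sampledGradient g η α τ x₀ ξ j i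
          - mean (sampledGradient g η α τ x₀ ξ j)) k := by
  induction k with
  | zero => simp [iterate, initialState, dampedSum, mean_const hm]
  | succ k ih =>
    rw [nextLocal_eq, mean_nextLocal g η α τ x₀ ξ hm, dampedSum, smul_comm, smul_add, ← ih]
    module

/-- Synchronization resets this gap to zero, which is damping with parameter `1` instead of `α`. -/
lemma mean_sub_anchor (hm : 0 < m) (k : ℕ) :
    mean (iterate g η α τ x₀ ξ k).x - (iterate g η α τ x₀ ξ k).z
      = -η • dampedSum 1 τ (fun j => mean (sampledGradient g η α τ x₀ ξ j)) k := by
  induction k with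
  | zero => simp [iterate, initialState, dampedSum, mean_const hm]
  | succ k ih =>
    rw [dampedSum, smul_comm, smul_add, ← ih, anchor_succ, mean_nextLocal g η α τ x₀ ξ hm, damping,
      damping]
    split_ifs <;> module

end Iteration

/-! ### Bounds along a path -/

section Pathwise

variable {E : Type*} [NormedAddCommGroup E] [InnerProductSpace ℝ E] {m : ℕ}

/-- The dispersion of the local models is controlled by the damped noise and by the
dissimilarity of the fields `f i`. -/
lemma sum_dispersion_le (hm : 0 < m) {f : Fin m → E → E} {L κ η α : ℝ} {τ : ℕ}
    (hL : ∀ i x y, ‖f i x - f i y‖ ≤ L * ‖x - y‖)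
    (hκ : ∀ x, ∑ i, ‖f i x - mean (fun j => f j x)‖ ^ 2 ≤ m * κ ^ 2)
    (hα₀ : 0 < α) (hα₁ : α ≤ 1) (hτ : 0 < τ) (hη : 60 * (η ^ 2 * L ^ 2 * (τ / α) ^ 2) ≤ 1)
    (x G : ℕ → Fin m → E)
    (hx : ∀ k i, x k i - mean (x k) = -η • dampedSum α τ (fun j => G j i - mean (G j)) k)
    (K : ℕ) :
    ∑ k ∈ Finset.range K, ∑ i, ‖x k i - mean (x k)‖ ^ 2 ≤
      4 * η ^ 2 * ∑ k ∈ Finset.range K, ∑ i, ‖dampedSum α τ (fun j => (G j i - f i (x j i))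
        - mean (fun l => G j l - f l (x j l))) k‖ ^ 2
      + 2 * η ^ 2 * (τ / α) ^ 2 * (K * (m * κ ^ 2)) := by
  let ε : ℕ → Fin m → E := fun j i => G j i - f i (x j i)
  let e : ℕ → Fin m → E := fun j i => f i (x j i) - f i (mean (x j))
  let s : ℕ → Fin m → E := fun j i => f i (mean (x j)) - mean (fun l => f l (mean (x j)))
  -- Three sources of dispersion: noise `N`, dissimilarity `R` of the fields at the common point
  -- `mean (x j)`, and the feedback `T` of the dispersion on itself.
  let N : ℕ → Fin m → E := fun k i => dampedSum α τ (fun j => ε j i - mean (ε j)) k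
  let R : ℕ → Fin m → E := fun k i => dampedSum α τ (fun j => s j i) k
  let T : ℕ → Fin m → E := fun k i => dampedSum α τ (fun j => e j i - mean (e j)) k
  have hsplit : ∀ k i, x k i - mean (x k) = -η • (N k i + R k i + T k i) := by
    intro k i
    rw [hx]
    simp only [N, R, T]
    rw [← dampedSum_add, ← dampedSum_add]
    congr 2
    funext j
    simp only [ε, e, s, mean_sub]
    have : mean (G j) = mean (fun i => G j i) := rfl
    rw [this]; abel
  have hpt : ∀ k i, ‖x k i - mean (x k)‖ ^ 2 ≤ η ^ 2 *
      (‖N k i‖ ^ 2 / (15 / 52) + ‖R k i‖ ^ 2 / (15 / 26) + ‖T k i‖ ^ 2 / (7 / 52)) := by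
    intro k i
    rw [hsplit, norm_smul, mul_pow, norm_neg, Real.norm_eq_abs, sq_abs]
    gcongr
    -- The feedback contributes at most `(52 / 7) / 60 = 13 / 105` of `U`. After moving it to the
    -- left, the factors `52 / 15` and `26 / 15` become `91 / 23 < 4` and `91 / 46 < 2`.
    exact norm_add_add_sq_le _ _ _ (by norm_num) (by norm_num) (by norm_num) (by norm_num)
  have hexch : ∀ p : ℕ → Fin m → E,
      ∑ k ∈ Finset.range K, ∑ i, ‖dampedSum α τ (fun j => p j i) k‖ ^ 2
        ≤ (τ / α) ^ 2 * ∑ k ∈ Finset.range K, ∑ i, ‖p k i‖ ^ 2 := by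
    intro p
    rw [Finset.sum_comm, Finset.sum_comm (s := Finset.range K) (f := fun k i => ‖p k i‖ ^ 2),
      Finset.mul_sum]
    exact Finset.sum_le_sum fun i _ => sum_norm_dampedSum_sq_le hα₀ hα₁ hτ _ K
  have hR : ∑ k ∈ Finset.range K, ∑ i, ‖R k i‖ ^ 2 ≤ (τ / α) ^ 2 * (K * (m * κ ^ 2)) := by
    refine (hexch s).trans ?_
    gcongr
    calc _ ≤ ∑ k ∈ Finset.range K, (m * κ ^ 2) := Finset.sum_le_sum fun k _ => hκ _
      _ = _ := by simp
  set U := ∑ k ∈ Finset.range K, ∑ i, ‖x k i - mean (x k)‖ ^ 2 with hU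
  have hT : ∑ k ∈ Finset.range K, ∑ i, ‖T k i‖ ^ 2 ≤ (τ / α) ^ 2 * (L ^ 2 * U) := by
    refine (hexch fun j i => e j i - mean (e j)).trans ?_
    gcongr
    rw [hU, Finset.mul_sum]
    refine Finset.sum_le_sum fun k _ => ?_
    rw [sum_norm_sub_mean_sq hm, Finset.mul_sum]
    refine (sub_le_self _ (by positivity)).trans (Finset.sum_le_sum fun i _ => ?_)
    rw [← mul_pow]
    exact pow_le_pow_left₀ (norm_nonneg _) (hL i _ _) 2
  have hsum : U ≤ η ^ 2 * ((∑ k ∈ Finset.range K, ∑ i, ‖N k i‖ ^ 2) / (15 / 52)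
      + (∑ k ∈ Finset.range K, ∑ i, ‖R k i‖ ^ 2) / (15 / 26)
      + (∑ k ∈ Finset.range K, ∑ i, ‖T k i‖ ^ 2) / (7 / 52)) := by
    rw [hU]
    simp only [Finset.sum_div, ← Finset.sum_add_distrib]
    rw [Finset.mul_sum]
    refine Finset.sum_le_sum fun k _ => ?_
    rw [Finset.mul_sum]
    exact Finset.sum_le_sum fun i _ => hpt k i
  have hU0 : 0 ≤ U := by positivity
  change U ≤ 4 * η ^ 2 * (∑ k ∈ Finset.range K, ∑ i, ‖N k i‖ ^ 2) + _
  set A := ∑ k ∈ Finset.range K, ∑ i, ‖N k i‖ ^ 2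
  have hA : 0 ≤ η ^ 2 * A := by positivity
  have h1 := mul_le_mul_of_nonneg_left hR (sq_nonneg η)
  have h2 := mul_le_mul_of_nonneg_left hT (sq_nonneg η)
  have h3 := mul_le_mul_of_nonneg_right hη hU0
  have hB : 0 ≤ η ^ 2 * ((τ / α) ^ 2 * (K * (m * κ ^ 2))) := by positivity
  nlinarith

/-- The gap between the mean field at `y` and the mean of the fields at the local models. -/
lemma natCast_mul_norm_mean_sub_sq_le (hm : 0 < m) {f : Fin m → E → E} {L : ℝ}
    (hL : ∀ i x y, ‖f i x - f i y‖ ≤ L * ‖x - y‖) (x : Fin m → E) (y : E) :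
    m * ‖mean (fun i => f i y) - mean (fun i => f i (x i))‖ ^ 2
      ≤ L ^ 2 * (∑ i, ‖x i - mean x‖ ^ 2 + m * ‖mean x - y‖ ^ 2) := by
  rw [← mean_sub, ← sum_norm_sub_sq hm, Finset.mul_sum]
  refine (natCast_mul_norm_mean_sq_le hm _).trans (Finset.sum_le_sum fun i _ => ?_)
  rw [← mul_pow, norm_sub_rev (x i)]
  exact pow_le_pow_left₀ (norm_nonneg _) (hL i _ _) 2

/-- The noise sums are left untouched, to be estimated in expectation. The field part of the anchor
gap is returned as a small multiple of the squared mean fields, which the descent inequality can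
absorb. -/
lemma sum_field_gap_le (hm : 0 < m) {f : Fin m → E → E} {L κ η α : ℝ} {τ : ℕ}
    (hL : ∀ i x y, ‖f i x - f i y‖ ≤ L * ‖x - y‖)
    (hκ : ∀ x, ∑ i, ‖f i x - mean (fun j => f j x)‖ ^ 2 ≤ m * κ ^ 2)
    (hα₀ : 0 < α) (hα₁ : α ≤ 1) (hτ : 0 < τ) (hη : 60 * (η ^ 2 * L ^ 2 * (τ / α) ^ 2) ≤ 1)
    (x G : ℕ → Fin m → E) (y : ℕ → E)
    (hx : ∀ k i, x k i - mean (x k) = -η • dampedSum α τ (fun j => G j i - mean (G j)) k)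
    (hy : ∀ k, mean (x k) - y k = -(α * η) • dampedSum 1 τ (fun j => mean (G j)) k)
    (K : ℕ) :
    ∑ k ∈ Finset.range K,
        ‖mean (fun i => f i (y k)) - mean (fun i => f i (x k i))‖ ^ 2 ≤
      L ^ 2 * η ^ 2 * ∑ k ∈ Finset.range K,
        (4 / m * ∑ i, ‖dampedSum α τ (fun j => (G j i - f i (x j i))
          - mean (fun l => G j l - f l (x j l))) k‖ ^ 2
        + 4 * ‖dampedSum 1 τ (fun j => mean (fun l => G j l - f l (x j l))) k‖ ^ 2)
      + 2 * L ^ 2 * η ^ 2 * (τ / α) ^ 2 * (K * κ ^ 2)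
      + 1 / 30 * ∑ k ∈ Finset.range K, ‖mean (fun i => f i (x k i))‖ ^ 2 := by
  have hm' : (0 : ℝ) < m := by exact_mod_cast hm
  have hdisp := sum_dispersion_le hm hL hκ hα₀ hα₁ hτ hη x G hx K
  set N := ∑ k ∈ Finset.range K, ∑ i, ‖dampedSum α τ (fun j => (G j i - f i (x j i))
    - mean (fun l => G j l - f l (x j l))) k‖ ^ 2
  set U := ∑ k ∈ Finset.range K, ∑ i, ‖x k i - mean (x k)‖ ^ 2 with hU
  let v : ℕ → E := fun k => dampedSum 1 τ (fun j => mean (fun l => G j l - f l (x j l))) k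
  let w : ℕ → E := fun k => dampedSum 1 τ (fun j => mean (fun l => f l (x j l))) k
  set H := ∑ k ∈ Finset.range K, ‖mean (fun i => f i (x k i))‖ ^ 2
  set V := ∑ k ∈ Finset.range K, ‖v k‖ ^ 2 with hV
  have hw : ∑ k ∈ Finset.range K, ‖w k‖ ^ 2 ≤ τ ^ 2 * H := by
    simpa using sum_norm_dampedSum_sq_le one_pos le_rfl hτ
      (fun j => mean (fun l => f l (x j l))) K
  have hbar : ∀ k, ‖mean (x k) - y k‖ ^ 2 ≤ 2 * (α * η) ^ 2 * (‖v k‖ ^ 2 + ‖w k‖ ^ 2) := by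
    intro k
    have : dampedSum 1 τ (fun j => mean (G j)) k = v k + w k := by
      simp only [v, w]
      rw [← dampedSum_add]
      congr 1
      funext j
      rw [← mean_add]
      simp
    rw [hy, this, norm_smul, mul_pow, norm_neg, Real.norm_eq_abs, sq_abs]
    have h1 : ‖v k + w k‖ ^ 2 ≤ 2 * (‖v k‖ ^ 2 + ‖w k‖ ^ 2) := by
      have := norm_add_le (v k) (w k)
      calc ‖v k + w k‖ ^ 2 ≤ (‖v k‖ + ‖w k‖) ^ 2 := by gcongr
        _ ≤ _ := add_sq_le
    nlinarith [sq_nonneg (α * η)]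
  have hgap : ∑ k ∈ Finset.range K,
        ‖mean (fun i => f i (y k)) - mean (fun i => f i (x k i))‖ ^ 2
      ≤ L ^ 2 * (U / m + 2 * (α * η) ^ 2 * (V + τ ^ 2 * H)) := by
    calc _ ≤ ∑ k ∈ Finset.range K, L ^ 2 * ((∑ i, ‖x k i - mean (x k)‖ ^ 2) / m
          + 2 * (α * η) ^ 2 * (‖v k‖ ^ 2 + ‖w k‖ ^ 2)) := by
          refine Finset.sum_le_sum fun k _ => ?_
          have h1 := natCast_mul_norm_mean_sub_sq_le hm hL (x k) (y k)
          have h2 : L ^ 2 * ((∑ i, ‖x k i - mean (x k)‖ ^ 2) / m + ‖mean (x k) - y k‖ ^ 2)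
              = L ^ 2 * (∑ i, ‖x k i - mean (x k)‖ ^ 2 + m * ‖mean (x k) - y k‖ ^ 2) / m := by
            field_simp
          have h3 : ‖mean (fun i => f i (y k)) - mean (fun i => f i (x k i))‖ ^ 2
              ≤ L ^ 2 * ((∑ i, ‖x k i - mean (x k)‖ ^ 2) / m + ‖mean (x k) - y k‖ ^ 2) := by
            rw [h2, le_div_iff₀ hm']; linarith
          refine h3.trans ?_
          gcongr
          exact hbar k
      _ = L ^ 2 * (U / m + 2 * (α * η) ^ 2 * (V + ∑ k ∈ Finset.range K, ‖w k‖ ^ 2)) := by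
          rw [← Finset.mul_sum, Finset.sum_add_distrib, ← Finset.sum_div, ← Finset.mul_sum,
            Finset.sum_add_distrib]
      _ ≤ _ := by gcongr
  have hsum : ∑ k ∈ Finset.range K,
        (4 / m * ∑ i, ‖dampedSum α τ (fun j => (G j i - f i (x j i))
          - mean (fun l => G j l - f l (x j l))) k‖ ^ 2
        + 4 * ‖dampedSum 1 τ (fun j => mean (fun l => G j l - f l (x j l))) k‖ ^ 2)
      = 4 / m * N + 4 * V := by
    rw [Finset.sum_add_distrib, ← Finset.mul_sum, ← Finset.mul_sum]
  rw [hsum]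
  refine hgap.trans ?_
  have hUm : U / m ≤ 4 / m * η ^ 2 * N + 2 * η ^ 2 * (τ / α) ^ 2 * (K * κ ^ 2) := by
    rw [div_le_iff₀ hm']
    refine hdisp.trans_eq ?_
    field_simp
  have hH : 0 ≤ H := by positivity
  have hV0 : 0 ≤ V := by positivity
  have hα2 : α ^ 2 ≤ 1 := by nlinarith
  -- Since `α ≤ 1`, the left side is at most `2 * η ^ 2 * L ^ 2 * (τ / α) ^ 2 ≤ 2 / 60`.
  have hcoef : L ^ 2 * (2 * (α * η) ^ 2) * τ ^ 2 ≤ 1 / 30 := by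
    have hατ : α ^ 2 * (τ : ℝ) ^ 2 ≤ (τ / α) ^ 2 := by
      rw [div_pow, le_div_iff₀ (by positivity)]
      have : α ^ 2 * α ^ 2 ≤ 1 := by nlinarith [sq_nonneg α]
      nlinarith [sq_nonneg (τ : ℝ)]
    have := mul_le_mul_of_nonneg_left hατ (by positivity : 0 ≤ η ^ 2 * L ^ 2)
    nlinarith
  have h1 := mul_le_mul_of_nonneg_left hUm (sq_nonneg L)
  have h2 := mul_le_mul_of_nonneg_right hcoef hH
  -- Rounding up to `4` gives the two noise energies the ratio `1 / m` to `1`, the combination whose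
  -- second moment closes under the recursion.
  have h3 : L ^ 2 * (2 * (α * η) ^ 2) * V ≤ L ^ 2 * η ^ 2 * (4 * V) := by
    have : 0 ≤ L ^ 2 * η ^ 2 * V := by positivity
    nlinarith
  linarith

/-- The descent inequality for the averaged model, summed along a path. -/
lemma sum_norm_gradient_sq_le [CompleteSpace E] (hm : 0 < m) {F : E → ℝ} {f : Fin m → E → E}
    {L κ η α F_inf : ℝ} {τ : ℕ}
    (hF : Differentiable ℝ F) (hf : ∀ x, gradient F x = mean (fun i => f i x))
    (hF_inf : ∀ x, F_inf ≤ F x) (hL₀ : 0 ≤ L)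
    (hL : ∀ i x y, ‖f i x - f i y‖ ≤ L * ‖x - y‖)
    (hκ : ∀ x, ∑ i, ‖f i x - mean (fun j => f j x)‖ ^ 2 ≤ m * κ ^ 2)
    (hα₀ : 0 < α) (hα₁ : α < 1) (hτ : 0 < τ) (hη₀ : 0 < η)
    (hη : 60 * (η ^ 2 * L ^ 2 * (τ / α) ^ 2) ≤ 1)
    (x G : ℕ → Fin m → E) (y : ℕ → E)
    (hx : ∀ k i, x k i - mean (x k) = -η • dampedSum α τ (fun j => G j i - mean (G j)) k)
    (hy : ∀ k, mean (x k) - y k = -(α * η) • dampedSum 1 τ (fun j => mean (G j)) k)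
    (hy' : ∀ k, y (k + 1) = y k - ((1 - α) * η) • mean (G k))
    (K : ℕ) :
    ∑ k ∈ Finset.range K, ‖gradient F (y k)‖ ^ 2 ≤
      2 / ((1 - α) * η) * (F (y 0) - F_inf)
      + 2 * L ^ 2 * η ^ 2 * (τ / α) ^ 2 * (K * κ ^ 2)
      + ∑ k ∈ Finset.range K,
        (L ^ 2 * η ^ 2 * (4 / m * ∑ i, ‖dampedSum α τ (fun j => (G j i - f i (x j i))
            - mean (fun l => G j l - f l (x j l))) k‖ ^ 2
          + 4 * ‖dampedSum 1 τ (fun j => mean (fun l => G j l - f l (x j l))) k‖ ^ 2)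
        + (1 - α) * η * L * ‖mean (fun l => G k l - f l (x k l))‖ ^ 2
        + inner ℝ ((2 * ((1 - α) * η) * L) • mean (fun l => f l (x k l))
            - (2 : ℝ) • gradient F (y k)) (mean (fun l => G k l - f l (x k l)))) := by
  set γ := (1 - α) * η with hγ
  have hγ0 : 0 < γ := mul_pos (by linarith) hη₀
  have hLF : ∀ x y, ‖gradient F x - gradient F y‖ ≤ L * ‖x - y‖ := by
    intro x y
    have hm' : (0 : ℝ) < m := by exact_mod_cast hm
    rw [hf, hf]
    have h1 := natCast_mul_norm_mean_sub_sq_le hm hL (fun _ => y) x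
    simp only [mean_const hm, sub_self, norm_zero] at h1
    refine abs_le_of_sq_le_sq' (le_of_mul_le_mul_left ?_ hm') (by positivity) |>.2
    refine h1.trans_eq ?_
    rw [norm_sub_rev y x]; simp; ring
  -- Since `τ / α ≥ 1`, the smallness condition bounds `η * L` itself. This leaves at least half of
  -- `-‖h k‖ ^ 2` unused.
  have hγL : γ * L ≤ 1 / 2 := by
    have h1 : (1 : ℝ) ≤ τ / α := by
      rw [le_div_iff₀ hα₀]
      have : (1 : ℝ) ≤ τ := by exact_mod_cast hτ
      linarith
    have h2 : (η * L) ^ 2 ≤ (1 / 2) ^ 2 := by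
      have h3 : (1 : ℝ) ≤ (τ / α) ^ 2 := by nlinarith
      have := mul_le_mul_of_nonneg_left h3 (by positivity : 0 ≤ η ^ 2 * L ^ 2)
      nlinarith
    have h3 : η * L ≤ 1 / 2 := (abs_le_of_sq_le_sq' h2 (by norm_num)).2
    have h4 : 0 ≤ η * L := by positivity
    nlinarith
  let ε : ℕ → E := fun k => mean (fun l => G k l - f l (x k l))
  let h : ℕ → E := fun k => mean (fun l => f l (x k l))
  have hG : ∀ k, mean (G k) = h k + ε k := fun k => by
    simp only [h, ε]; rw [← mean_add]; simp
  -- Descent lemma along `-γ • (h k + ε k)`, with twice the inner product of the gradient and `h k`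
  -- rewritten by polarization; all terms linear in `ε k` are collected in one inner product.
  have hstep : ∀ k, ‖gradient F (y k)‖ ^ 2 ≤ 2 / γ * (F (y k) - F (y (k + 1)))
      - 1 / 2 * ‖h k‖ ^ 2 + ‖gradient F (y k) - h k‖ ^ 2 + γ * L * ‖ε k‖ ^ 2
      + inner ℝ ((2 * γ * L) • h k - (2 : ℝ) • gradient F (y k)) (ε k) := by
    intro k
    have h1 := le_add_inner_gradient_add_sq hF hLF (y k) (-(γ • mean (G k)))
    rw [← sub_eq_add_neg, ← hy' k, norm_neg, norm_smul, mul_pow, Real.norm_eq_abs, sq_abs,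
      inner_neg_right, inner_smul_right, hG, norm_add_sq_real, inner_add_right] at h1
    have h2 := norm_sub_sq_real (gradient F (y k)) (h k)
    rw [inner_sub_left, inner_smul_left, inner_smul_left]
    simp only [conj_trivial]
    have h3 : 2 / γ * (F (y k) - F (y (k + 1))) ≥ 2 / γ * (γ * (inner ℝ (gradient F (y k)) (h k)
        + inner ℝ (gradient F (y k)) (ε k))
        - L / 2 * (γ ^ 2 * (‖h k‖ ^ 2 + 2 * inner ℝ (h k) (ε k) + ‖ε k‖ ^ 2))) := by
      exact mul_le_mul_of_nonneg_left (by linarith) (by positivity)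
    have h4 : 2 / γ * (γ * (inner ℝ (gradient F (y k)) (h k)
        + inner ℝ (gradient F (y k)) (ε k))
        - L / 2 * (γ ^ 2 * (‖h k‖ ^ 2 + 2 * inner ℝ (h k) (ε k) + ‖ε k‖ ^ 2)))
        = 2 * (inner ℝ (gradient F (y k)) (h k) + inner ℝ (gradient F (y k)) (ε k))
        - γ * L * (‖h k‖ ^ 2 + 2 * inner ℝ (h k) (ε k) + ‖ε k‖ ^ 2) := by
      field_simp
    rw [h4] at h3
    have h5 := mul_le_mul_of_nonneg_right hγL (sq_nonneg ‖h k‖)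
    linarith
  have hgap := sum_field_gap_le hm hL hκ hα₀ hα₁.le hτ hη x G y hx hy K
  simp only [← hf] at hgap
  have hH : 0 ≤ ∑ k ∈ Finset.range K, ‖h k‖ ^ 2 := by positivity
  have htel := Finset.sum_range_sub' (fun k => F (y k)) K
  have hsum := Finset.sum_le_sum fun k (_ : k ∈ Finset.range K) => hstep k
  simp only [Finset.sum_add_distrib, Finset.sum_sub_distrib, ← Finset.mul_sum] at hsum hgap ⊢
  rw [Finset.sum_sub_distrib] at htel
  rw [htel] at hsum
  have hend : 2 / γ * (F (y 0) - F (y K)) ≤ 2 / γ * (F (y 0) - F_inf) := by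
    gcongr; exact hF_inf _
  simp only [h, ε] at hsum hH
  -- The term `1 / 30` from the field gap is covered by the `-1 / 2` in `hstep`.
  linarith

end Pathwise

/-! ### Moments of the noise -/

section Orthogonal

variable {H : Type*} [NormedAddCommGroup H] [InnerProductSpace ℝ H] {m : ℕ}

lemma inner_dampedSum_eq_zero (α : ℝ) (τ : ℕ) (p : ℕ → H) (q : H) (k : ℕ)
    (h : ∀ j < k, inner ℝ (p j) q = 0) : inner ℝ (dampedSum α τ p k) q = 0 := by
  induction k with
  | zero => simp [dampedSum]
  | succ k ih =>
    rw [dampedSum, inner_smul_left, inner_add_left, ih fun j hj => h j (by omega), h k (by omega)]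
    simp

/-- Pythagoras: a new increment orthogonal to all earlier ones is orthogonal to their damped sum. -/
lemma norm_dampedSum_succ_sq (α : ℝ) (τ : ℕ) (p : ℕ → H) (k : ℕ)
    (h : ∀ j < k, inner ℝ (p j) (p k) = 0) :
    ‖dampedSum α τ p (k + 1)‖ ^ 2
      = damping α τ k ^ 2 * (‖dampedSum α τ p k‖ ^ 2 + ‖p k‖ ^ 2) := by
  rw [dampedSum, norm_smul, mul_pow, Real.norm_eq_abs, sq_abs, norm_add_sq_real,
    inner_dampedSum_eq_zero α τ p (p k) k h]
  ring

lemma inner_mean_left (a : Fin m → H) (b : H) (h : ∀ i, inner ℝ (a i) b = 0) :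
    inner ℝ (mean a) b = 0 := by
  simp [mean, inner_smul_left, sum_inner, h]

lemma inner_mean_right (a : H) (b : Fin m → H) (h : ∀ i, inner ℝ a (b i) = 0) :
    inner ℝ a (mean b) = 0 := by
  rw [real_inner_comm]
  exact inner_mean_left b a fun i => by rw [real_inner_comm, h]

lemma norm_mean_sq_le_of_orthogonal (hm : 0 < m) {e : Fin m → H} {σ : ℝ}
    (horth : ∀ i l, i ≠ l → inner ℝ (e i) (e l) = 0) (hσ : ∀ i, ‖e i‖ ^ 2 ≤ σ ^ 2) :
    ‖mean e‖ ^ 2 ≤ σ ^ 2 / m := by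
  have hm' : (0 : ℝ) < m := by exact_mod_cast hm
  have h1 : ‖∑ i, e i‖ ^ 2 = ∑ i, ‖e i‖ ^ 2 := by
    rw [← real_inner_self_eq_norm_sq, sum_inner]
    refine Finset.sum_congr rfl fun i _ => ?_
    rw [inner_sum, Finset.sum_eq_single i (fun l _ hl => horth i l hl.symm) (by simp),
      real_inner_self_eq_norm_sq]
  have h2 : ∑ i, ‖e i‖ ^ 2 ≤ m * σ ^ 2 := by
    simpa using Finset.sum_le_sum fun i (_ : i ∈ Finset.univ) => hσ i
  rw [mean, norm_smul, mul_pow, h1, Real.norm_of_nonneg (by positivity)]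
  calc (1 / (m : ℝ)) ^ 2 * ∑ i, ‖e i‖ ^ 2 ≤ (1 / (m : ℝ)) ^ 2 * (m * σ ^ 2) := by gcongr
    _ = _ := by field_simp

/-- The damped sums of an orthogonal family, for the deviations from the mean and the mean. -/
lemma sum_norm_dampedSum_orthogonal_le (hm : 0 < m) {α : ℝ} (hα₀ : 0 < α) (hα₁ : α < 1)
    {τ : ℕ} (hτ : 0 < τ) {e : ℕ → Fin m → H} {σ : ℝ}
    (horth : ∀ j k i l, j < k → inner ℝ (e j i) (e k l) = 0)
    (hσ : ∀ k i, ‖e k i‖ ^ 2 ≤ σ ^ 2) (k : ℕ) :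
    ∑ i, ‖dampedSum α τ (fun j => e j i - mean (e j)) k‖ ^ 2
      + m * ‖dampedSum 1 τ (fun j => mean (e j)) k‖ ^ 2
      ≤ m * σ ^ 2 * (τ * (1 - α) ^ 2 / (α * (2 - α)) + (k % τ : ℕ)) := by
  have hm' : (0 : ℝ) < m := by exact_mod_cast hm
  have h2α : 0 < 2 - α := by linarith
  have hmean : ∀ j k i, j < k → inner ℝ (mean (e j)) (e k i) = 0 := fun j k i hjk =>
    inner_mean_left _ _ fun l => horth j k l i hjk
  induction k with
  | zero => simp [dampedSum]; positivity
  | succ k ih =>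
    have h1 : ∀ i, ∀ j < k, inner ℝ (e j i - mean (e j)) (e k i - mean (e k)) = 0 := by
      intro i j hj
      rw [inner_sub_left, inner_sub_right, inner_sub_right, horth _ _ _ _ hj, hmean _ _ _ hj,
        inner_mean_right _ _ fun l => horth _ _ _ l hj,
        inner_mean_right _ _ fun l => hmean _ _ l hj]
      simp
    have h2 : ∀ j < k, inner ℝ (mean (e j)) (mean (e k)) = 0 := fun j hj =>
      inner_mean_right _ _ fun l => hmean _ _ l hj
    -- The term `m * ‖mean (e k)‖ ^ 2` subtracted here is what the second sum gains between
    -- synchronizations, so each step adds at most `m * σ ^ 2`. No orthogonality between workers of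
    -- one iteration is needed.
    have h3 : ∑ i, ‖dampedSum α τ (fun j => e j i - mean (e j)) (k + 1)‖ ^ 2
        = damping α τ k ^ 2 * (∑ i, ‖dampedSum α τ (fun j => e j i - mean (e j)) k‖ ^ 2
          + (∑ i, ‖e k i‖ ^ 2 - m * ‖mean (e k)‖ ^ 2)) := by
      rw [← sum_norm_sub_mean_sq hm, ← Finset.sum_add_distrib, Finset.mul_sum]
      exact Finset.sum_congr rfl fun i _ => norm_dampedSum_succ_sq α τ _ k (h1 i)
    have h4 := norm_dampedSum_succ_sq 1 τ (fun j => mean (e j)) k h2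
    have h5 : ∑ i, ‖e k i‖ ^ 2 ≤ m * σ ^ 2 := by
      simpa using Finset.sum_le_sum fun i (_ : i ∈ Finset.univ) => hσ k i
    rw [h3, h4]
    set N := ∑ i, ‖dampedSum α τ (fun j => e j i - mean (e j)) k‖ ^ 2
    set V := ‖dampedSum 1 τ (fun j => mean (e j)) k‖ ^ 2
    have hV : 0 ≤ m * V := by positivity
    have hM : 0 ≤ m * ‖mean (e k)‖ ^ 2 := by positivity
    rcases damping_cases α hτ k with ⟨h6, h7, h8⟩ | ⟨h6, h7⟩
    · have h9 : damping 1 τ k = 0 := by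
        rcases damping_cases 1 hτ k with ⟨h, -⟩ | ⟨-, h⟩
        · simpa using h
        · rw [h8] at h
          have : (0 : ℝ) ≤ (k % τ : ℕ) := by positivity
          linarith
      rw [h6, h8, h9]
      rw [h7] at ih
      -- The bound is the periodic solution of the recursion with factor `(1 - α) ^ 2`, using `(1 -
      -- α) ^ 2 + α * (2 - α) = 1`.
      have h10 : m * σ ^ 2 * (τ * (1 - α) ^ 2 / (α * (2 - α)) + 0) = (1 - α) ^ 2 *
          (m * σ ^ 2 * (τ * (1 - α) ^ 2 / (α * (2 - α)) + (τ - 1)) + m * σ ^ 2) := by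
        field_simp; ring
      rw [h10]
      have h11 : N + (∑ i, ‖e k i‖ ^ 2 - m * ‖mean (e k)‖ ^ 2) ≤
          m * σ ^ 2 * (τ * (1 - α) ^ 2 / (α * (2 - α)) + (τ - 1)) + m * σ ^ 2 := by linarith
      have := mul_le_mul_of_nonneg_left h11 (sq_nonneg (1 - α))
      linarith
    · have h9 : damping 1 τ k = 1 := by
        rcases damping_cases 1 hτ k with ⟨-, -, h⟩ | ⟨h, -⟩
        · rw [h7] at h
          have : (0 : ℝ) ≤ (k % τ : ℕ) := by positivity
          linarith
        · exact h
      rw [h6, h7, h9]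
      linarith

end Orthogonal

/-! ### Transfer of the Hilbert space estimates to random vectors, as elements of `L²`. -/

section SquareIntegrable

variable {Ω E : Type*} [MeasurableSpace Ω] [NormedAddCommGroup E] [InnerProductSpace ℝ E]
  {P : Measure Ω} {m : ℕ}

lemma inner_toLp {f h : Ω → E} (hf : MemLp f 2 P) (hh : MemLp h 2 P) :
    inner ℝ (hf.toLp f) (hh.toLp h) = ∫ ω, inner ℝ (f ω) (h ω) ∂P := by
  rw [L2.inner_def]
  refine integral_congr_ae ?_
  filter_upwards [hf.coeFn_toLp, hh.coeFn_toLp] with ω h1 h2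
  rw [h1, h2]

lemma norm_toLp_sq {f : Ω → E} (hf : MemLp f 2 P) :
    ‖hf.toLp f‖ ^ 2 = ∫ ω, ‖f ω‖ ^ 2 ∂P := by
  rw [← real_inner_self_eq_norm_sq, inner_toLp]
  simp

lemma memLp_dampedSum {α : ℝ} {τ : ℕ} {p : ℕ → Ω → E} (hp : ∀ j, MemLp (p j) 2 P) (k : ℕ) :
    MemLp (fun ω => dampedSum α τ (fun j => p j ω) k) 2 P := by
  induction k with
  | zero => exact MemLp.zero
  | succ k ih => exact (ih.add (hp k)).const_smul _

lemma toLp_dampedSum {α : ℝ} {τ : ℕ} {p : ℕ → Ω → E} (hp : ∀ j, MemLp (p j) 2 P) (k : ℕ) :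
    (memLp_dampedSum (α := α) (τ := τ) hp k).toLp _
      = dampedSum α τ (fun j => (hp j).toLp (p j)) k := by
  induction k with
  | zero => exact MemLp.toLp_zero _
  | succ k ih =>
    rw [dampedSum, ← ih, ← MemLp.toLp_add, ← MemLp.toLp_const_smul]
    rfl

lemma memLp_mean {p : Fin m → Ω → E} (hp : ∀ i, MemLp (p i) 2 P) :
    MemLp (fun ω => mean (fun i => p i ω)) 2 P :=
  (memLp_finsetSum Finset.univ fun i _ => hp i).const_smul _

lemma toLp_mean {p : Fin m → Ω → E} (hp : ∀ i, MemLp (p i) 2 P) :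
    (memLp_mean hp).toLp _ = mean (fun i => (hp i).toLp (p i)) := by
  have h : ∀ s : Finset (Fin m), (memLp_finsetSum s fun i _ => hp i).toLp _
      = ∑ i ∈ s, (hp i).toLp (p i) := by
    intro s
    induction s using Finset.induction_on with
    | empty => exact MemLp.toLp_zero _
    | insert a s ha ih =>
      rw [Finset.sum_insert ha, ← ih, ← MemLp.toLp_add]
      congr 1
      funext ω
      simp [Finset.sum_insert ha]
  rw [mean, ← h, ← MemLp.toLp_const_smul]
  rfl

/-- Second moments of the damped sums of an orthogonal noise. -/
lemma integral_dampedSum_noise_le (hm : 0 < m) {α : ℝ} (hα₀ : 0 < α) (hα₁ : α < 1)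
    {τ : ℕ} (hτ : 0 < τ) {ε : ℕ → Fin m → Ω → E} {σ : ℝ} (hε : ∀ k i, MemLp (ε k i) 2 P)
    (horth : ∀ j k i l, j < k → ∫ ω, inner ℝ (ε j i ω) (ε k l ω) ∂P = 0)
    (hσ : ∀ k i, ∫ ω, ‖ε k i ω‖ ^ 2 ∂P ≤ σ ^ 2) (k : ℕ) :
    ∑ i, ∫ ω, ‖dampedSum α τ (fun j => ε j i ω - mean (fun l => ε j l ω)) k‖ ^ 2 ∂P
      + m * ∫ ω, ‖dampedSum 1 τ (fun j => mean (fun l => ε j l ω)) k‖ ^ 2 ∂P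
      ≤ m * σ ^ 2 * (τ * (1 - α) ^ 2 / (α * (2 - α)) + (k % τ : ℕ)) := by
  have h := sum_norm_dampedSum_orthogonal_le hm hα₀ hα₁ hτ (σ := σ)
    (e := fun k i => (hε k i).toLp (ε k i))
    (fun j k i l hjk => by rw [inner_toLp, horth j k i l hjk])
    (fun k i => by rw [norm_toLp_sq]; exact hσ k i) k
  simp only [← toLp_mean (fun i => hε _ i), ← MemLp.toLp_sub] at h
  rw [← toLp_dampedSum (fun j => memLp_mean (hε j)), norm_toLp_sq] at h
  simp only [← toLp_dampedSum (fun j => (hε j _).sub (memLp_mean (hε j))), norm_toLp_sq] at h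
  exact h

lemma integral_norm_mean_noise_sq_le (hm : 0 < m) {ε : Fin m → Ω → E} {σ : ℝ}
    (hε : ∀ i, MemLp (ε i) 2 P)
    (horth : ∀ i l, i ≠ l → ∫ ω, inner ℝ (ε i ω) (ε l ω) ∂P = 0)
    (hσ : ∀ i, ∫ ω, ‖ε i ω‖ ^ 2 ∂P ≤ σ ^ 2) :
    ∫ ω, ‖mean (fun i => ε i ω)‖ ^ 2 ∂P ≤ σ ^ 2 / m := by
  have h := norm_mean_sq_le_of_orthogonal hm (σ := σ) (e := fun i => (hε i).toLp (ε i))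
    (fun i l hil => by rw [inner_toLp, horth i l hil])
    (fun i => by rw [norm_toLp_sq]; exact hσ i)
  rwa [← toLp_mean hε, norm_toLp_sq] at h

end SquareIntegrable

/-! ### Noise at a random point independent of the sample. -/

section Noise

variable {Ω S E : Type*} [MeasurableSpace Ω] [MeasurableSpace S] [NormedAddCommGroup E]
  [SecondCountableTopology E] [MeasurableSpace E] [BorelSpace E] {P : Measure Ω}
  [IsProbabilityMeasure P] {D : Measure S} [IsProbabilityMeasure D]
  {G : E → S → E} {f : E → E} {σ : ℝ} {x : Ω → E} {ζ : Ω → S}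

/-- The noise at a random point that is independent of the sample is square integrable, with the
variance bound that holds at every fixed point. -/
lemma memLp_noise (hG : Measurable (Function.uncurry G)) (hf : Measurable f)
    (hvar : ∀ x, Integrable (fun s => ‖G x s - f x‖ ^ 2) D ∧ ∫ s, ‖G x s - f x‖ ^ 2 ∂D ≤ σ ^ 2)
    (hx : Measurable x) (hζ : Measurable ζ) (hlaw : P.map ζ = D) (hind : IndepFun x ζ P) :
    MemLp (fun ω => G (x ω) (ζ ω) - f (x ω)) 2 P ∧
      ∫ ω, ‖G (x ω) (ζ ω) - f (x ω)‖ ^ 2 ∂P ≤ σ ^ 2 := by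
  have hε : Measurable fun q : E × S => G q.1 q.2 - f q.1 := hG.sub (hf.comp measurable_fst)
  have hmeas : Measurable fun ω => G (x ω) (ζ ω) - f (x ω) := hε.comp (hx.prodMk hζ)
  have hmap := (indepFun_iff_map_prod_eq_prod_map_map hx.aemeasurable hζ.aemeasurable).1 hind
  have : IsProbabilityMeasure (P.map x) := Measure.isProbabilityMeasure_map hx.aemeasurable
  -- Tonelli needs no integrability, so the variance bound and square integrability come out
  -- together.
  have hle : ∫⁻ ω, ENNReal.ofReal (‖G (x ω) (ζ ω) - f (x ω)‖ ^ 2) ∂P ≤ ENNReal.ofReal (σ ^ 2) := by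
    have hF : Measurable fun q : E × S => ENNReal.ofReal (‖G q.1 q.2 - f q.1‖ ^ 2) :=
      (hε.norm.pow_const 2).ennreal_ofReal
    have h1 := lintegral_map (μ := P) hF (hx.prodMk hζ)
    rw [← h1, hmap, hlaw, lintegral_prod _ hF.aemeasurable]
    calc _ ≤ ∫⁻ _, ENNReal.ofReal (σ ^ 2) ∂(P.map x) := by
          refine lintegral_mono fun a => ?_
          rw [← ofReal_integral_eq_lintegral_ofReal (hvar a).1
            (Filter.Eventually.of_forall fun _ => by positivity)]
          exact ENNReal.ofReal_le_ofReal (hvar a).2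
      _ = _ := by simp
  have hint : Integrable (fun ω => ‖G (x ω) (ζ ω) - f (x ω)‖ ^ 2) P := by
    refine ⟨(hmeas.norm.pow_const 2).aestronglyMeasurable, ?_⟩
    rw [hasFiniteIntegral_iff_ofReal (Filter.Eventually.of_forall fun _ => by positivity)]
    exact hle.trans_lt ENNReal.ofReal_lt_top
  refine ⟨(memLp_two_iff_integrable_sq_norm hmeas.aestronglyMeasurable).2 hint, ?_⟩
  rw [integral_eq_lintegral_of_nonneg_ae (Filter.Eventually.of_forall fun _ => by positivity)
    hint.aestronglyMeasurable]
  exact ENNReal.toReal_le_of_le_ofReal (by positivity) hle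

lemma integrable_inner_of_memLp {Ω E : Type*} [MeasurableSpace Ω] {P : Measure Ω}
    [NormedAddCommGroup E] [InnerProductSpace ℝ E] {f h : Ω → E} (hf : MemLp f 2 P)
    (hh : MemLp h 2 P) : Integrable (fun ω => inner ℝ (f ω) (h ω)) P := by
  refine (L2.integrable_inner (𝕜 := ℝ) (hf.toLp f) (hh.toLp h)).congr ?_
  filter_upwards [hf.coeFn_toLp, hh.coeFn_toLp] with ω h1 h2
  rw [h1, h2]

/-- The noise is orthogonal to every square integrable vector that is independent of the sample. -/
lemma integral_inner_noise_eq_zero [InnerProductSpace ℝ E] [CompleteSpace E]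
    (hG : Measurable (Function.uncurry G)) (hf : Measurable f)
    (hunb : ∀ x, Integrable (G x) D ∧ ∫ s, G x s ∂D = f x)
    (hx : Measurable x) (hζ : Measurable ζ) (hlaw : P.map ζ = D) {V : Ω → E} (hV : Measurable V)
    (hind : IndepFun (fun ω => (x ω, V ω)) ζ P) (hV2 : MemLp V 2 P)
    (hε2 : MemLp (fun ω => G (x ω) (ζ ω) - f (x ω)) 2 P) :
    ∫ ω, inner ℝ (V ω) (G (x ω) (ζ ω) - f (x ω)) ∂P = 0 := by
  let Φ : (E × E) × S → ℝ := fun q => inner ℝ q.1.2 (G q.1.1 q.2 - f q.1.1)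
  have hΦ : Measurable Φ := by
    refine Measurable.inner (measurable_snd.comp measurable_fst) (Measurable.sub ?_ ?_)
    · exact hG.comp ((measurable_fst.comp measurable_fst).prodMk measurable_snd)
    · exact hf.comp (measurable_fst.comp measurable_fst)
  have hxV : Measurable fun ω => (x ω, V ω) := hx.prodMk hV
  have hmap := (indepFun_iff_map_prod_eq_prod_map_map hxV.aemeasurable hζ.aemeasurable).1 hind
  have : IsProbabilityMeasure (P.map fun ω => (x ω, V ω)) :=
    Measure.isProbabilityMeasure_map hxV.aemeasurable
  have hint : Integrable Φ ((P.map fun ω => (x ω, V ω)).prod D) := by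
    rw [← hlaw, ← hmap, integrable_map_measure hΦ.aestronglyMeasurable
      (hxV.prodMk hζ).aemeasurable]
    exact integrable_inner_of_memLp hV2 hε2
  have h1 := integral_map (μ := P) (hxV.prodMk hζ).aemeasurable hΦ.aestronglyMeasurable
  change ∫ ω, Φ ((x ω, V ω), ζ ω) ∂P = 0
  rw [← h1, hmap, hlaw, integral_prod _ hint]
  -- With the point and the vector frozen, unbiasedness makes the integral over the sample vanish.
  have h2 : ∀ q : E × E, ∫ s, Φ (q, s) ∂D = 0 := by
    intro q
    simp only [Φ]
    rw [integral_inner (f := fun s => G q.1 s - f q.1) ((hunb q.1).1.sub (integrable_const _)),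
      integral_sub (hunb q.1).1 (integrable_const _), (hunb q.1).2]
    simp
  simp [h2]

end Noise

/-! ### Independence of one sample from all the others. -/

section Independence

variable {Ω S ι A : Type*} [MeasurableSpace S] [MeasurableSpace A]

/-- The information in all samples but one. -/
@[reducible] def otherSamples (ζ : ι → Ω → S) (q : ι) : MeasurableSpace Ω :=
  ⨆ p ∈ ({q}ᶜ : Set ι), MeasurableSpace.comap (ζ p) inferInstance

lemma measurable_otherSamples (ζ : ι → Ω → S) {p q : ι} (hpq : p ≠ q) :
    Measurable[otherSamples ζ q] (ζ p) := by
  rw [measurable_iff_comap_le]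
  exact le_iSup₂_of_le (f := fun p (_ : p ∈ ({q}ᶜ : Set ι)) =>
    MeasurableSpace.comap (ζ p) inferInstance) p hpq le_rfl

/-- Independent families grouped over the disjoint index sets `{q}ᶜ` and `{q}` stay independent.
Removing a single sample, rather than using the past filtration, also covers other workers in the
same iteration. -/
lemma indepFun_of_measurable_otherSamples [MeasurableSpace Ω] {P : Measure Ω}
    {ζ : ι → Ω → S} (hζ : ∀ p, Measurable (ζ p)) (hind : iIndepFun ζ P)
    {q : ι} {U : Ω → A} (hU : Measurable[otherSamples ζ q] U) :
    IndepFun U (ζ q) P := by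
  have h := indep_iSup_of_disjoint (fun p => (hζ p).comap_le) hind
    (disjoint_compl_left : Disjoint ({q}ᶜ : Set ι) {q})
  rw [IndepFun_iff_Indep]
  refine indep_of_indep_of_le_left (indep_of_indep_of_le_right h ?_) ?_
  · simp
  · exact measurable_iff_comap_le.1 hU

end Independence

section Measurability

variable {Ω S : Type*} [mΩ : MeasurableSpace Ω] [MeasurableSpace S] {d m : ℕ}
  {g : Fin m → EuclideanSpace ℝ (Fin d) → S → EuclideanSpace ℝ (Fin d)}
  {η α : ℝ} {τ : ℕ} {x₀ : EuclideanSpace ℝ (Fin d)} {ξ : ℕ → Fin m → Ω → S}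

lemma measurable_mean {p : Fin m → Ω → EuclideanSpace ℝ (Fin d)} (hp : ∀ i, Measurable (p i)) :
    Measurable fun ω => mean (fun i => p i ω) :=
  (Finset.measurable_fun_sum Finset.univ fun i _ => hp i).const_smul (1 / (m : ℝ))

/-- Only samples before iteration `k` enter, and the σ-algebra on `Ω` is arbitrary, so the lemma
also gives measurability with respect to `otherSamples`. -/
lemma measurable_iterate (hg : ∀ i, Measurable (Function.uncurry (g i))) (k : ℕ)
    (hξ : ∀ j < k, ∀ i, Measurable (ξ j i)) :
    (∀ i, Measurable fun ω => (iterate g η α τ x₀ (fun j i => ξ j i ω) k).x i) ∧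
      Measurable fun ω => (iterate g η α τ x₀ (fun j i => ξ j i ω) k).z := by
  induction k with
  | zero => exact ⟨fun i => measurable_const, measurable_const⟩
  | succ k ih =>
    obtain ⟨hx, hz⟩ := ih fun j hj => hξ j (by omega)
    have hx' : ∀ i, Measurable fun ω =>
        (iterate g η α τ x₀ (fun j i => ξ j i ω) (k + 1)).x i := by
      intro i
      simp only [nextLocal_eq, sampledGradient]
      exact (((hx i).sub (((hg i).comp ((hx i).prodMk (hξ k (by omega) i))).const_smul
        η)).const_smul (damping α τ k)).add
        (hz.const_smul (1 - damping α τ k))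
    refine ⟨hx', ?_⟩
    simp only [anchor_succ]
    split_ifs
    · exact measurable_mean hx'
    · exact hz

lemma measurable_virtualModel (hg : ∀ i, Measurable (Function.uncurry (g i))) (k : ℕ)
    (hξ : ∀ j < k, ∀ i, Measurable (ξ j i)) :
    Measurable fun ω => virtualModel α (iterate g η α τ x₀ (fun j i => ξ j i ω) k) := by
  obtain ⟨hx, hz⟩ := measurable_iterate (η := η) (α := α) (τ := τ) (x₀ := x₀) hg k hξ
  simp only [virtualModel_eq]
  exact ((measurable_mean hx).const_smul (1 - α)).add (hz.const_smul α)

lemma measurable_sampledGradient (hg : ∀ i, Measurable (Function.uncurry (g i))) (k : ℕ)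
    (i : Fin m) (hξ : ∀ j < k, ∀ i, Measurable (ξ j i)) (hξk : Measurable (ξ k i)) :
    Measurable fun ω => sampledGradient g η α τ x₀ (fun j i => ξ j i ω) k i :=
  (hg i).comp (((measurable_iterate hg k hξ).1 i).prodMk hξk)

end Measurability

lemma memLp_two_comp_lipschitz {Ω E : Type*} [MeasurableSpace Ω] {P : Measure Ω}
    [IsFiniteMeasure P] [NormedAddCommGroup E] {f : E → E} {L : ℝ}
    (hL : ∀ x y, ‖f x - f y‖ ≤ L * ‖x - y‖) {x : Ω → E} (hx : MemLp x 2 P) :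
    MemLp (fun ω => f (x ω)) 2 P := by
  have hf : LipschitzWith L.toNNReal f := by
    refine LipschitzWith.of_dist_le_mul fun x y => ?_
    rw [dist_eq_norm, dist_eq_norm]
    refine (hL x y).trans ?_
    gcongr
    exact Real.le_coe_toNNReal L
  have h1 : MemLp (fun ω => L * ‖x ω - 0‖ + ‖f 0‖) 2 P :=
    ((by simpa using hx.norm : MemLp (fun ω => ‖x ω - 0‖) 2 P).const_mul L).add (memLp_const _)
  refine h1.mono (hf.continuous.comp_aestronglyMeasurable hx.aestronglyMeasurable)
    (Filter.Eventually.of_forall fun ω => ?_)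
  have h2 : ‖f (x ω)‖ ≤ L * ‖x ω - 0‖ + ‖f 0‖ := by
    have := norm_sub_norm_le (f (x ω)) (f 0)
    linarith [hL (x ω) 0]
  exact h2.trans (le_abs_self _)

section Moments

variable {Ω S : Type*} [mΩ : MeasurableSpace Ω] [MeasurableSpace S] {d m : ℕ}
  {g : Fin m → EuclideanSpace ℝ (Fin d) → S → EuclideanSpace ℝ (Fin d)}
  {f : Fin m → EuclideanSpace ℝ (Fin d) → EuclideanSpace ℝ (Fin d)}
  {η α L σ : ℝ} {τ : ℕ} {x₀ : EuclideanSpace ℝ (Fin d)} {ξ : ℕ → Fin m → Ω → S}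
  {D : Fin m → Measure S} {P : Measure Ω}

/-- The deviation of the stochastic gradient of worker `i` in iteration `k` from its mean. -/
def gradientNoise (g : Fin m → EuclideanSpace ℝ (Fin d) → S → EuclideanSpace ℝ (Fin d))
    (f : Fin m → EuclideanSpace ℝ (Fin d) → EuclideanSpace ℝ (Fin d)) (η α : ℝ) (τ : ℕ)
    (x₀ : EuclideanSpace ℝ (Fin d)) (ξ : ℕ → Fin m → Ω → S) (k : ℕ) (i : Fin m) (ω : Ω) :
    EuclideanSpace ℝ (Fin d) :=
  sampledGradient g η α τ x₀ (fun j i => ξ j i ω) k i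
    - f i ((iterate g η α τ x₀ (fun j i => ξ j i ω) k).x i)

lemma measurable_gradientNoise (hg : ∀ i, Measurable (Function.uncurry (g i)))
    (hf : ∀ i, Measurable (f i)) (k : ℕ)
    (i : Fin m) (hξ : ∀ j < k, ∀ i, Measurable (ξ j i)) (hξk : Measurable (ξ k i)) :
    Measurable (gradientNoise g f η α τ x₀ ξ k i) :=
  (measurable_sampledGradient hg k i hξ hξk).sub
    ((hf i).comp ((measurable_iterate hg k hξ).1 i))

/-- A vector computed without the sample `ξ k i` is independent of it, jointly with the
local model. -/
lemma indepFun_local_prod (hg : ∀ i, Measurable (Function.uncurry (g i)))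
    (hξ : ∀ k i, Measurable (ξ k i))
    (hindep : iIndepFun (fun p : ℕ × Fin m => ξ p.1 p.2) P) (k : ℕ) (i : Fin m)
    {V : Ω → EuclideanSpace ℝ (Fin d)}
    (hV : Measurable[otherSamples (fun p : ℕ × Fin m => ξ p.1 p.2) (k, i)] V) :
    IndepFun (fun ω => ((iterate g η α τ x₀ (fun j i => ξ j i ω) k).x i, V ω)) (ξ k i) P := by
  refine indepFun_of_measurable_otherSamples (ζ := fun p : ℕ × Fin m => ξ p.1 p.2)
    (q := (k, i)) (fun p => hξ p.1 p.2) hindep ?_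
  refine Measurable.prodMk ?_ hV
  refine (measurable_iterate (mΩ := otherSamples _ (k, i)) (ξ := ξ) hg k fun j hj l => ?_).1 i
  exact measurable_otherSamples (fun p : ℕ × Fin m => ξ p.1 p.2) (p := (j, l))
    (by simp [hj.ne])

variable [∀ i, IsProbabilityMeasure (D i)] [IsProbabilityMeasure P]

lemma memLp_gradientNoise (hg : ∀ i, Measurable (Function.uncurry (g i)))
    (hf : ∀ i, Measurable (f i))
    (hvar : ∀ i x, Integrable (fun s => ‖g i x s - f i x‖ ^ 2) (D i) ∧
      ∫ s, ‖g i x s - f i x‖ ^ 2 ∂(D i) ≤ σ ^ 2)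
    (hξ : ∀ k i, Measurable (ξ k i)) (hlaw : ∀ k i, P.map (ξ k i) = D i)
    (hindep : iIndepFun (fun p : ℕ × Fin m => ξ p.1 p.2) P) (k : ℕ) (i : Fin m) :
    MemLp (gradientNoise g f η α τ x₀ ξ k i) 2 P ∧
      ∫ ω, ‖gradientNoise g f η α τ x₀ ξ k i ω‖ ^ 2 ∂P ≤ σ ^ 2 := by
  have hind := indepFun_local_prod (η := η) (α := α) (τ := τ) (x₀ := x₀) hg hξ hindep k i
    (V := fun _ => 0) (@measurable_const _ _ _ (otherSamples _ _) _)
  exact memLp_noise (hg i) (hf i) (hvar i) ((measurable_iterate hg k fun j _ => hξ j).1 i)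
    (hξ k i) (hlaw k i) (hind.comp measurable_fst measurable_id)

lemma integral_inner_gradientNoise_eq_zero (hg : ∀ i, Measurable (Function.uncurry (g i)))
    (hf : ∀ i, Measurable (f i))
    (hunb : ∀ i x, Integrable (g i x) (D i) ∧ ∫ s, g i x s ∂(D i) = f i x)
    (hvar : ∀ i x, Integrable (fun s => ‖g i x s - f i x‖ ^ 2) (D i) ∧
      ∫ s, ‖g i x s - f i x‖ ^ 2 ∂(D i) ≤ σ ^ 2)
    (hξ : ∀ k i, Measurable (ξ k i)) (hlaw : ∀ k i, P.map (ξ k i) = D i)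
    (hindep : iIndepFun (fun p : ℕ × Fin m => ξ p.1 p.2) P) (k : ℕ) (i : Fin m)
    {V : Ω → EuclideanSpace ℝ (Fin d)} (hVm : Measurable V)
    (hV : Measurable[otherSamples (fun p : ℕ × Fin m => ξ p.1 p.2) (k, i)] V)
    (hV2 : MemLp V 2 P) :
    ∫ ω, inner ℝ (V ω) (gradientNoise g f η α τ x₀ ξ k i ω) ∂P = 0 :=
  integral_inner_noise_eq_zero (hg i) (hf i) (hunb i)
    ((measurable_iterate hg k fun j _ => hξ j).1 i) (hξ k i) (hlaw k i) hVm
    (indepFun_local_prod hg hξ hindep k i hV) hV2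
    (memLp_gradientNoise hg hf hvar hξ hlaw hindep k i).1

/-- The noise at `(j, i)` uses `ξ j i` and samples of iterations before `j ≤ k`, hence never `ξ k
l`. Equality `j = k` covers two workers in one iteration. -/
lemma integral_inner_gradientNoise_of_ne (hg : ∀ i, Measurable (Function.uncurry (g i)))
    (hf : ∀ i, Measurable (f i))
    (hunb : ∀ i x, Integrable (g i x) (D i) ∧ ∫ s, g i x s ∂(D i) = f i x)
    (hvar : ∀ i x, Integrable (fun s => ‖g i x s - f i x‖ ^ 2) (D i) ∧
      ∫ s, ‖g i x s - f i x‖ ^ 2 ∂(D i) ≤ σ ^ 2)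
    (hξ : ∀ k i, Measurable (ξ k i)) (hlaw : ∀ k i, P.map (ξ k i) = D i)
    (hindep : iIndepFun (fun p : ℕ × Fin m => ξ p.1 p.2) P) {j k : ℕ} {i l : Fin m}
    (hjk : j ≤ k) (hne : (j, i) ≠ (k, l)) :
    ∫ ω, inner ℝ (gradientNoise g f η α τ x₀ ξ j i ω) (gradientNoise g f η α τ x₀ ξ k l ω) ∂P
      = 0 := by
  refine integral_inner_gradientNoise_eq_zero hg hf hunb hvar hξ hlaw hindep k l
    (measurable_gradientNoise hg hf j i (fun j _ => hξ j) (hξ j i)) ?_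
    (memLp_gradientNoise hg hf hvar hξ hlaw hindep j i).1
  refine measurable_gradientNoise (mΩ := otherSamples _ (k, l)) hg hf j i (fun j' hj' i' => ?_) ?_
  · exact measurable_otherSamples (fun p : ℕ × Fin m => ξ p.1 p.2) (p := (j', i'))
      (by simp [(hj'.trans_le hjk).ne])
  · exact measurable_otherSamples (fun p : ℕ × Fin m => ξ p.1 p.2) (p := (j, i)) hne

/-- Each step adds square integrable noise and a Lipschitz image of a square integrable vector. -/
lemma memLp_iterate (hg : ∀ i, Measurable (Function.uncurry (g i)))
    (hf : ∀ i, Measurable (f i)) (hL : ∀ i x y, ‖f i x - f i y‖ ≤ L * ‖x - y‖)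
    (hvar : ∀ i x, Integrable (fun s => ‖g i x s - f i x‖ ^ 2) (D i) ∧
      ∫ s, ‖g i x s - f i x‖ ^ 2 ∂(D i) ≤ σ ^ 2)
    (hξ : ∀ k i, Measurable (ξ k i)) (hlaw : ∀ k i, P.map (ξ k i) = D i)
    (hindep : iIndepFun (fun p : ℕ × Fin m => ξ p.1 p.2) P) (k : ℕ) :
    (∀ i, MemLp (fun ω => (iterate g η α τ x₀ (fun j i => ξ j i ω) k).x i) 2 P) ∧
      MemLp (fun ω => (iterate g η α τ x₀ (fun j i => ξ j i ω) k).z) 2 P := by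
  induction k with
  | zero => exact ⟨fun i => memLp_const x₀, memLp_const x₀⟩
  | succ k ih =>
    obtain ⟨hx, hz⟩ := ih
    have hG : ∀ i, MemLp
        (fun ω => sampledGradient g η α τ x₀ (fun j i => ξ j i ω) k i) 2 P := by
      intro i
      have h : (fun ω => sampledGradient g η α τ x₀ (fun j i => ξ j i ω) k i)
          = gradientNoise g f η α τ x₀ ξ k i
            + fun ω => f i ((iterate g η α τ x₀ (fun j i => ξ j i ω) k).x i) := by
        funext ω
        simp [gradientNoise]
      rw [h]
      exact (memLp_gradientNoise hg hf hvar hξ hlaw hindep k i).1.add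
        (memLp_two_comp_lipschitz (hL i) (hx i))
    have hx' : ∀ i, MemLp (fun ω =>
        (iterate g η α τ x₀ (fun j i => ξ j i ω) (k + 1)).x i) 2 P := by
      intro i
      simp only [nextLocal_eq]
      exact (((hx i).sub ((hG i).const_smul η)).const_smul (damping α τ k)).add
        (hz.const_smul (1 - damping α τ k))
    refine ⟨hx', ?_⟩
    simp only [anchor_succ]
    split_ifs
    · exact memLp_mean hx'
    · exact hz

lemma memLp_virtualModel (hg : ∀ i, Measurable (Function.uncurry (g i)))
    (hf : ∀ i, Measurable (f i)) (hL : ∀ i x y, ‖f i x - f i y‖ ≤ L * ‖x - y‖)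
    (hvar : ∀ i x, Integrable (fun s => ‖g i x s - f i x‖ ^ 2) (D i) ∧
      ∫ s, ‖g i x s - f i x‖ ^ 2 ∂(D i) ≤ σ ^ 2)
    (hξ : ∀ k i, Measurable (ξ k i)) (hlaw : ∀ k i, P.map (ξ k i) = D i)
    (hindep : iIndepFun (fun p : ℕ × Fin m => ξ p.1 p.2) P) (k : ℕ) :
    MemLp (fun ω => virtualModel α (iterate g η α τ x₀ (fun j i => ξ j i ω) k)) 2 P := by
  obtain ⟨hx, hz⟩ := memLp_iterate (η := η) (α := α) (τ := τ) (x₀ := x₀) hg hf hL hvar hξ hlaw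
    hindep k
  simp only [virtualModel_eq]
  exact ((memLp_mean hx).const_smul (1 - α)).add (hz.const_smul α)

end Moments

/-! ### The bound in expectation -/

section ExpectedGradient

variable {Ω S : Type*} [mΩ : MeasurableSpace Ω] [MeasurableSpace S] {d m : ℕ}
  {g : Fin m → EuclideanSpace ℝ (Fin d) → S → EuclideanSpace ℝ (Fin d)}
  {f : Fin m → EuclideanSpace ℝ (Fin d) → EuclideanSpace ℝ (Fin d)}
  {F : EuclideanSpace ℝ (Fin d) → ℝ}
  {η α L σ κ F_inf : ℝ} {τ : ℕ} {x₀ : EuclideanSpace ℝ (Fin d)} {ξ : ℕ → Fin m → Ω → S}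
  {D : Fin m → Measure S} [∀ i, IsProbabilityMeasure (D i)]
  {P : Measure Ω} [IsProbabilityMeasure P]

/-- Independence across iterations and workers makes the averaged noise orthogonal to every
square integrable vector that depends on earlier samples only. -/
lemma integral_inner_mean_noise_eq_zero (hg : ∀ i, Measurable (Function.uncurry (g i)))
    (hf : ∀ i, Measurable (f i))
    (hunb : ∀ i x, Integrable (g i x) (D i) ∧ ∫ s, g i x s ∂(D i) = f i x)
    (hvar : ∀ i x, Integrable (fun s => ‖g i x s - f i x‖ ^ 2) (D i) ∧
      ∫ s, ‖g i x s - f i x‖ ^ 2 ∂(D i) ≤ σ ^ 2)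
    (hξ : ∀ k i, Measurable (ξ k i)) (hlaw : ∀ k i, P.map (ξ k i) = D i)
    (hindep : iIndepFun (fun p : ℕ × Fin m => ξ p.1 p.2) P) (k : ℕ)
    {V : Ω → EuclideanSpace ℝ (Fin d)} (hVm : Measurable V)
    (hV : ∀ i, Measurable[otherSamples (fun p : ℕ × Fin m => ξ p.1 p.2) (k, i)] V)
    (hV2 : MemLp V 2 P) :
    ∫ ω, inner ℝ (V ω) (mean fun i => gradientNoise g f η α τ x₀ ξ k i ω) ∂P = 0 := by
  have hε := fun i => (memLp_gradientNoise (η := η) (α := α) (τ := τ) (x₀ := x₀) hg hf hvar hξ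
    hlaw hindep k i).1
  rw [← inner_toLp hV2 (memLp_mean hε), toLp_mean hε]
  refine inner_mean_right _ _ fun i => ?_
  rw [inner_toLp]
  exact integral_inner_gradientNoise_eq_zero hg hf hunb hvar hξ hlaw hindep k i hVm (hV i) hV2

/-- The expected squared gradient norms along the virtual averaged model, for any small enough
learning rate. -/
lemma sum_integral_norm_gradient_sq_le (hm : 0 < m)
    (hg : ∀ i, Measurable (Function.uncurry (g i)))
    (hF : Differentiable ℝ F) (hFf : ∀ x, gradient F x = mean (fun i => f i x))
    (hF_inf : ∀ x, F_inf ≤ F x) (hL₀ : 0 ≤ L)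
    (hf : ∀ i, Measurable (f i)) (hL : ∀ i x y, ‖f i x - f i y‖ ≤ L * ‖x - y‖)
    (hκ : ∀ x, ∑ i, ‖f i x - mean (fun j => f j x)‖ ^ 2 ≤ m * κ ^ 2)
    (hunb : ∀ i x, Integrable (g i x) (D i) ∧ ∫ s, g i x s ∂(D i) = f i x)
    (hvar : ∀ i x, Integrable (fun s => ‖g i x s - f i x‖ ^ 2) (D i) ∧
      ∫ s, ‖g i x s - f i x‖ ^ 2 ∂(D i) ≤ σ ^ 2)
    (hξ : ∀ k i, Measurable (ξ k i)) (hlaw : ∀ k i, P.map (ξ k i) = D i)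
    (hindep : iIndepFun (fun p : ℕ × Fin m => ξ p.1 p.2) P)
    (hα₀ : 0 < α) (hα₁ : α < 1) (hτ : 0 < τ) (hη₀ : 0 < η)
    (hη : 60 * (η ^ 2 * L ^ 2 * (τ / α) ^ 2) ≤ 1) (K : ℕ) :
    (∀ k, Integrable (fun ω =>
      ‖gradient F (virtualModel α (iterate g η α τ x₀ (fun j i => ξ j i ω) k))‖ ^ 2) P) ∧
    ∑ k ∈ Finset.range K,
      ∫ ω, ‖gradient F (virtualModel α (iterate g η α τ x₀ (fun j i => ξ j i ω) k))‖ ^ 2 ∂P ≤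
      2 / ((1 - α) * η) * (F (virtualModel α (initialState m x₀)) - F_inf)
      + 2 * L ^ 2 * η ^ 2 * (τ / α) ^ 2 * (K * κ ^ 2)
      + K * (L ^ 2 * η ^ 2 * (4 * σ ^ 2 * (τ / (α * (2 - α)) - 1))
        + (1 - α) * η * L * (σ ^ 2 / m)) := by
  have hm' : (0 : ℝ) < m := by exact_mod_cast hm
  let X : ℕ → Ω → State d m := fun k ω => iterate g η α τ x₀ (fun j i => ξ j i ω) k
  let y : ℕ → Ω → EuclideanSpace ℝ (Fin d) := fun k ω => virtualModel α (X k ω)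
  let ε : ℕ → Fin m → Ω → EuclideanSpace ℝ (Fin d) := gradientNoise g f η α τ x₀ ξ
  have hX2 : ∀ k i, MemLp (fun ω => (X k ω).x i) 2 P := fun k =>
    (memLp_iterate hg hf hL hvar hξ hlaw hindep k).1
  have hy2 : ∀ k, MemLp (y k) 2 P := memLp_virtualModel hg hf hL hvar hξ hlaw hindep
  have hε2 : ∀ k i, MemLp (ε k i) 2 P := fun k i =>
    (memLp_gradientNoise hg hf hvar hξ hlaw hindep k i).1
  have hεσ : ∀ k i, ∫ ω, ‖ε k i ω‖ ^ 2 ∂P ≤ σ ^ 2 := fun k i =>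
    (memLp_gradientNoise hg hf hvar hξ hlaw hindep k i).2
  have hh2 : ∀ k, MemLp (fun ω => mean fun i => f i ((X k ω).x i)) 2 P := fun k =>
    memLp_mean fun i => memLp_two_comp_lipschitz (hL i) (hX2 k i)
  have hgrad2 : ∀ k, MemLp (fun ω => gradient F (y k ω)) 2 P := fun k => by
    simp only [hFf]
    exact memLp_mean fun i => memLp_two_comp_lipschitz (hL i) (hy2 k)
  have hint : ∀ k, Integrable (fun ω => ‖gradient F (y k ω)‖ ^ 2) P := fun k =>
    (hgrad2 k).integrable_norm_pow two_ne_zero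
  refine ⟨hint, ?_⟩
  let N : ℕ → Fin m → Ω → EuclideanSpace ℝ (Fin d) := fun k i ω =>
    dampedSum α τ (fun j => ε j i ω - mean (fun l => ε j l ω)) k
  let v : ℕ → Ω → EuclideanSpace ℝ (Fin d) := fun k ω =>
    dampedSum 1 τ (fun j => mean (fun l => ε j l ω)) k
  let V : ℕ → Ω → EuclideanSpace ℝ (Fin d) := fun k ω =>
    (2 * ((1 - α) * η) * L) • (mean fun i => f i ((X k ω).x i)) - (2 : ℝ) • gradient F (y k ω)
  have hN2 : ∀ k i, Integrable (fun ω => ‖N k i ω‖ ^ 2) P := fun k i =>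
    (memLp_dampedSum (fun j => (hε2 j i).sub (memLp_mean (hε2 j))) k).integrable_norm_pow
      two_ne_zero
  have hv2 : ∀ k, Integrable (fun ω => ‖v k ω‖ ^ 2) P := fun k =>
    (memLp_dampedSum (fun j => memLp_mean (hε2 j)) k).integrable_norm_pow two_ne_zero
  have hm2 : ∀ k, Integrable (fun ω => ‖mean (fun i => ε k i ω)‖ ^ 2) P := fun k =>
    (memLp_mean (hε2 k)).integrable_norm_pow two_ne_zero
  have hV2 : ∀ k, MemLp (V k) 2 P := fun k =>
    ((hh2 k).const_smul (2 * ((1 - α) * η) * L)).sub ((hgrad2 k).const_smul (2 : ℝ))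
  have hcross : ∀ k, Integrable (fun ω => inner ℝ (V k ω) (mean fun i => ε k i ω)) P := fun k =>
    integrable_inner_of_memLp (hV2 k) (memLp_mean (hε2 k))
  -- The σ-algebra is a parameter: it is needed for the ambient one and for each `otherSamples`.
  have hVmeas : ∀ (mΩ' : MeasurableSpace Ω) k, (∀ j < k, ∀ i, Measurable (ξ j i)) →
      Measurable (V k) := by
    intro mΩ' k hξ'
    have hx := (measurable_iterate (η := η) (α := α) (τ := τ) (x₀ := x₀) hg k hξ').1
    have hy := measurable_virtualModel (η := η) (α := α) (τ := τ) (x₀ := x₀) hg k hξ'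
    simp only [V, hFf]
    exact ((measurable_mean fun i => (hf i).comp (hx i)).const_smul (2 * ((1 - α) * η) * L)).sub
      ((measurable_mean fun i => (hf i).comp hy).const_smul (2 : ℝ))
  have hcross0 : ∀ k, ∫ ω, inner ℝ (V k ω) (mean fun i => ε k i ω) ∂P = 0 := fun k =>
    integral_inner_mean_noise_eq_zero hg hf hunb hvar hξ hlaw hindep k
      (hVmeas mΩ k fun j _ => hξ j)
      (fun i => hVmeas (otherSamples _ (k, i)) k fun j hj l =>
        measurable_otherSamples (fun p : ℕ × Fin m => ξ p.1 p.2) (p := (j, l)) (by simp [hj.ne]))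
      (hV2 k)
  have hpath : ∀ ω, ∑ k ∈ Finset.range K, ‖gradient F (y k ω)‖ ^ 2 ≤
      2 / ((1 - α) * η) * (F (virtualModel α (initialState m x₀)) - F_inf)
      + 2 * L ^ 2 * η ^ 2 * (τ / α) ^ 2 * (K * κ ^ 2)
      + ∑ k ∈ Finset.range K,
        (L ^ 2 * η ^ 2 * (4 / m * ∑ i, ‖N k i ω‖ ^ 2 + 4 * ‖v k ω‖ ^ 2)
        + (1 - α) * η * L * ‖mean (fun l => ε k l ω)‖ ^ 2
        + inner ℝ (V k ω) (mean (fun l => ε k l ω))) := fun ω =>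
    sum_norm_gradient_sq_le hm hF hFf hF_inf hL₀ hL hκ hα₀ hα₁ hτ hη₀ hη
      (fun k => (X k ω).x) (fun k => sampledGradient g η α τ x₀ (fun j i => ξ j i ω) k)
      (fun k => y k ω) (fun k i => local_sub_mean g η α τ x₀ _ hm k i)
      (fun k => by
        have h := mean_sub_anchor g η α τ x₀ (fun j i => ξ j i ω) hm k
        rw [← mul_neg, ← smul_smul, ← h]
        simp only [y, virtualModel_eq]
        module)
      (fun k => virtualModel_succ g η α τ x₀ _ hm k) K
  have hterm : ∀ k, Integrable (fun ω =>
      L ^ 2 * η ^ 2 * (4 / m * ∑ i, ‖N k i ω‖ ^ 2 + 4 * ‖v k ω‖ ^ 2)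
        + (1 - α) * η * L * ‖mean (fun l => ε k l ω)‖ ^ 2
        + inner ℝ (V k ω) (mean (fun l => ε k l ω))) P := fun k =>
    ((((integrable_finsetSum _ fun i _ => hN2 k i).const_mul _).add ((hv2 k).const_mul
      _)).const_mul _ |>.add ((hm2 k).const_mul _)).add (hcross k)
  have hval : ∀ k, ∫ ω, (L ^ 2 * η ^ 2 * (4 / m * ∑ i, ‖N k i ω‖ ^ 2 + 4 * ‖v k ω‖ ^ 2)
        + (1 - α) * η * L * ‖mean (fun l => ε k l ω)‖ ^ 2
        + inner ℝ (V k ω) (mean (fun l => ε k l ω))) ∂P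
      ≤ L ^ 2 * η ^ 2 * (4 * σ ^ 2 * (τ / (α * (2 - α)) - 1))
        + (1 - α) * η * L * (σ ^ 2 / m) := by
    intro k
    have hS : Integrable (fun ω => ∑ i, ‖N k i ω‖ ^ 2) P :=
      integrable_finsetSum _ fun i _ => hN2 k i
    have hA : Integrable (fun ω => 4 / m * ∑ i, ‖N k i ω‖ ^ 2 + 4 * ‖v k ω‖ ^ 2) P :=
      (hS.const_mul _).add ((hv2 k).const_mul _)
    have hB : Integrable (fun ω => L ^ 2 * η ^ 2 *
        (4 / m * ∑ i, ‖N k i ω‖ ^ 2 + 4 * ‖v k ω‖ ^ 2)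
        + (1 - α) * η * L * ‖mean (fun l => ε k l ω)‖ ^ 2) P :=
      (hA.const_mul _).add ((hm2 k).const_mul _)
    rw [integral_add hB (hcross k), hcross0 k, add_zero,
      integral_add (hA.const_mul _) ((hm2 k).const_mul _), integral_const_mul, integral_const_mul,
      integral_add (hS.const_mul _) ((hv2 k).const_mul _), integral_const_mul, integral_const_mul,
      integral_finsetSum _ fun i _ => hN2 k i]
    have h1 := integral_dampedSum_noise_le hm hα₀ hα₁ hτ hε2 (fun j k i l hjk =>
      integral_inner_gradientNoise_of_ne hg hf hunb hvar hξ hlaw hindep hjk.le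
        (by simp [hjk.ne])) hεσ k
    have h2 := integral_norm_mean_noise_sq_le hm (hε2 k) (fun i l hil =>
      integral_inner_gradientNoise_of_ne hg hf hunb hvar hξ hlaw hindep le_rfl
        (by simp [hil])) (hεσ k)
    have h3 : 4 / m * ∑ i, ∫ ω, ‖N k i ω‖ ^ 2 ∂P + 4 * ∫ ω, ‖v k ω‖ ^ 2 ∂P
        ≤ 4 * σ ^ 2 * (τ / (α * (2 - α)) - 1) := by
      have h2α : 0 < 2 - α := by linarith
      have hmod : ((k % τ : ℕ) : ℝ) + 1 ≤ τ := by exact_mod_cast Nat.mod_lt k hτ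
      -- From `(1 - α) ^ 2 = 1 - α * (2 - α)` and `k % τ ≤ τ - 1`; the latter produces the `-1`.
      have h4 : τ * (1 - α) ^ 2 / (α * (2 - α)) + (k % τ : ℕ) ≤ τ / (α * (2 - α)) - 1 := by
        have : τ * (1 - α) ^ 2 / (α * (2 - α)) = τ / (α * (2 - α)) - τ := by
          field_simp; ring
        linarith
      calc _ = 4 / m * (∑ i, ∫ ω, ‖N k i ω‖ ^ 2 ∂P + m * ∫ ω, ‖v k ω‖ ^ 2 ∂P) := by
            field_simp
        _ ≤ 4 / m * (m * σ ^ 2 * (τ * (1 - α) ^ 2 / (α * (2 - α)) + (k % τ : ℕ))) := by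
            gcongr
        _ ≤ 4 / m * (m * σ ^ 2 * (τ / (α * (2 - α)) - 1)) := by gcongr
        _ = _ := by field_simp
    have h1α : 0 ≤ 1 - α := by linarith
    gcongr
  rw [← integral_finsetSum _ fun k _ => hint k]
  calc _ ≤ ∫ ω, _ ∂P := integral_mono (integrable_finsetSum _ fun k _ => hint k)
        ((integrable_const _).add (integrable_finsetSum _ fun k _ => hterm k)) hpath
    _ ≤ _ := by
      rw [integral_add' (integrable_const _) (integrable_finsetSum _ fun k _ => hterm k),
        integral_finsetSum _ fun k _ => hterm k]
      simp only [integral_const, probReal_univ, one_smul]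
      gcongr
      refine (Finset.sum_le_sum fun k _ => hval k).trans_eq ?_
      simp [mul_add]

end ExpectedGradient

/-! ### Substitution of the learning rate, and the final bound. -/

lemma learningRate_sq {L : ℝ} (hL : 0 < L) (m K : ℕ) :
    learningRate L m K ^ 2 * L ^ 2 = m / K := by
  rw [learningRate, mul_pow, Real.sq_sqrt (by positivity)]
  field_simp

lemma learningRate_mul {L : ℝ} (hL : 0 < L) {m K : ℕ} (hK : 0 < K) :
    learningRate L m K * L * K = Real.sqrt (m * K) := by
  have hK' : (0 : ℝ) < K := by exact_mod_cast hK
  rw [learningRate, Real.sqrt_div (by positivity), Real.sqrt_mul (by positivity)]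
  have : Real.sqrt K * Real.sqrt K = K := Real.mul_self_sqrt hK'.le
  have h0 : Real.sqrt K ≠ 0 := by positivity
  field_simp
  rw [pow_two, this]

/-- The bound for the learning rate `√(m / K) / L` is at most `errorBound`. -/
lemma average_le_errorBound {L Δ σ κ α : ℝ} {τ m K : ℕ} (hL : 0 < L) (hΔ : 0 ≤ Δ)
    (hα₀ : 0 < α) (hα₁ : α < 1) (hm : 0 < m) (hK : 0 < K) :
    1 / (K : ℝ) * (2 / ((1 - α) * learningRate L m K) * Δ
      + 2 * L ^ 2 * learningRate L m K ^ 2 * (τ / α) ^ 2 * (K * κ ^ 2)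
      + K * (L ^ 2 * learningRate L m K ^ 2 * (4 * σ ^ 2 * (τ / (α * (2 - α)) - 1))
        + (1 - α) * learningRate L m K * L * (σ ^ 2 / m)))
      ≤ errorBound L Δ σ κ α τ m K := by
  have hK' : (0 : ℝ) < K := by exact_mod_cast hK
  have hm' : (0 : ℝ) < m := by exact_mod_cast hm
  have h1α : 0 < 1 - α := by linarith
  have h2α : 0 < 2 - α := by linarith
  have hsq := learningRate_sq hL m K
  have hmul := learningRate_mul hL (m := m) hK
  have hs : 0 < Real.sqrt (m * K) := by positivity
  have hss : Real.sqrt (m * K) * Real.sqrt (m * K) = m * K := Real.mul_self_sqrt (by positivity)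
  set η := learningRate L m K
  set s := Real.sqrt (m * K)
  have hη : η = s / (L * K) := by rw [← hmul]; field_simp
  have h1 : 1 / (K : ℝ) * (2 / ((1 - α) * η) * Δ) = 2 * L * Δ / ((1 - α) * s) := by
    rw [hη]; field_simp
  have h2 : 1 / (K : ℝ) * (2 * L ^ 2 * η ^ 2 * (τ / α) ^ 2 * (K * κ ^ 2))
      = 2 * m * τ ^ 2 * κ ^ 2 / (α ^ 2 * K) := by
    calc _ = 2 * (η ^ 2 * L ^ 2) * (τ / α) ^ 2 * κ ^ 2 := by field_simp
      _ = _ := by rw [hsq]; field_simp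
  have h3 : L ^ 2 * η ^ 2 * (4 * σ ^ 2 * (τ / (α * (2 - α)) - 1))
      = 2 * m * σ ^ 2 / K * (2 / ((2 - α) * α) * τ - 2) := by
    rw [mul_comm (L ^ 2), hsq]; field_simp; ring
  have h4 : (1 - α) * η * L * (σ ^ 2 / m) = (1 - α) * σ ^ 2 / s := by
    rw [hη]; field_simp; rw [pow_two, hss]; ring
  -- The argument yields better constants than `errorBound`: `2` for `4` here, then `1` for `2`, and
  -- `-2` for `-1`.
  have h5 : 2 * L * Δ / ((1 - α) * s) ≤ 4 * L * Δ / ((1 - α) * s) := by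
    gcongr; norm_num
  have h6 : (1 - α) * σ ^ 2 / s ≤ 2 * (1 - α) * σ ^ 2 / s := by
    gcongr; linarith
  have h7 : 2 * m * σ ^ 2 / K * (2 / ((2 - α) * α) * τ - 2)
      ≤ 2 * m * σ ^ 2 / K * (2 / ((2 - α) * α) * τ - 1) := by
    gcongr; norm_num
  rw [mul_add, mul_add, h1, h2, h3, h4, ← mul_assoc, one_div_mul_cancel hK'.ne', one_mul,
    errorBound]
  linarith

/-- The bound is a combination of `1 / √(mK)` and `m / K` with coefficients free of `m` and `K`;
absolute values are taken because the parameters have no assumed signs. -/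
lemma exists_abs_errorBound_le (L Δ σ κ α : ℝ) (τ : ℕ) :
    ∃ C₁ C₂ : ℝ, ∀ m K : ℕ, 0 < m → 0 < K →
      |errorBound L Δ σ κ α τ m K|
        ≤ C₁ / Real.sqrt ((m : ℝ) * (K : ℝ)) + C₂ * (m : ℝ) / (K : ℝ) := by
  refine ⟨|4 * L * Δ / (1 - α) + 2 * (1 - α) * σ ^ 2|,
    |2 * σ ^ 2 * (2 / ((2 - α) * α) * τ - 1) + 2 * τ ^ 2 * κ ^ 2 / α ^ 2|, fun m K hm hK => ?_⟩
  have hs : 0 < Real.sqrt ((m : ℝ) * (K : ℝ)) := by positivity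
  have h : errorBound L Δ σ κ α τ m K
      = (4 * L * Δ / (1 - α) + 2 * (1 - α) * σ ^ 2) / Real.sqrt (m * K)
        + (2 * σ ^ 2 * (2 / ((2 - α) * α) * τ - 1) + 2 * τ ^ 2 * κ ^ 2 / α ^ 2) * m / K := by
    rw [errorBound, ← div_div, ← div_div]
    ring
  rw [h]
  refine (abs_add_le _ _).trans_eq ?_
  rw [abs_div, abs_of_pos hs, abs_div, abs_mul, Nat.abs_cast, Nat.abs_cast]

lemma hasGradientAt_objective {d m : ℕ} {S : Type*} [MeasurableSpace S]
    {ℓ : EuclideanSpace ℝ (Fin d) → S → ℝ} {D : Fin m → Measure S}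
    (hdiff : ∀ i, Differentiable ℝ (localObjective ℓ D i)) (x : EuclideanSpace ℝ (Fin d)) :
    HasGradientAt (objective ℓ D) (mean fun i => gradient (localObjective ℓ D i) x) x := by
  rw [hasGradientAt_iff_hasFDerivAt, mean, map_smul, map_sum]
  have h := (HasFDerivAt.fun_sum (u := Finset.univ)
    fun i _ => (hdiff i x).hasGradientAt.hasFDerivAt).const_mul (1 / (m : ℝ))
  exact h

end

end OverlapLocalSGD

open OverlapLocalSGD in
theorem theorem1 {d m : ℕ} {S Ω : Type*} [MeasurableSpace S] [MeasurableSpace Ω]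
    (hm : 0 < m)
    -- data distributions, loss, stochastic gradients
    (D : Fin m → Measure S) [∀ i, IsProbabilityMeasure (D i)]
    (ℓ : EuclideanSpace ℝ (Fin d) → S → ℝ)
    (hℓ : ∀ i x, Integrable (ℓ x) (D i))
    (g : Fin m → EuclideanSpace ℝ (Fin d) → S → EuclideanSpace ℝ (Fin d))
    (hg : ∀ i, Measurable (Function.uncurry (g i)))
    (L σ κ F_inf : ℝ) (hL : 0 < L)
    -- `F_inf` is a lower bound of the objective
    (hF_inf : ∀ x, F_inf ≤ OverlapLocalSGD.objective ℓ D x)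
    -- every local objective is `L`-smooth
    (hdiff : ∀ i, Differentiable ℝ (OverlapLocalSGD.localObjective ℓ D i))
    (hsmooth : ∀ i x y,
      ‖gradient (OverlapLocalSGD.localObjective ℓ D i) x
        - gradient (OverlapLocalSGD.localObjective ℓ D i) y‖ ≤ L * ‖x - y‖)
    -- unbiased stochastic gradients
    (hunbiased : ∀ i x, Integrable (g i x) (D i) ∧
      ∫ s, g i x s ∂(D i) = gradient (OverlapLocalSGD.localObjective ℓ D i) x)
    -- bounded variance
    (hvar : ∀ i x,
      Integrable (fun s => ‖g i x s - gradient (OverlapLocalSGD.localObjective ℓ D i) x‖ ^ 2)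
        (D i) ∧
      ∫ s, ‖g i x s - gradient (OverlapLocalSGD.localObjective ℓ D i) x‖ ^ 2 ∂(D i) ≤ σ ^ 2)
    -- bounded gradient dissimilarity
    (hdissim : ∀ x, (1 / (m : ℝ)) * ∑ i,
      ‖gradient (OverlapLocalSGD.localObjective ℓ D i) x
        - gradient (OverlapLocalSGD.objective ℓ D) x‖ ^ 2 ≤ κ ^ 2)
    -- the samples `ξ k i ∼ D i`, independent over iterations and workers
    (P : Measure Ω) [IsProbabilityMeasure P]
    (ξ : ℕ → Fin m → Ω → S)
    (hξ : ∀ k i, Measurable (ξ k i))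
    (hlaw : ∀ k i, P.map (ξ k i) = D i)
    (hindep : iIndepFun (fun p : ℕ × Fin m => ξ p.1 p.2) P)
    -- parameters of the run
    (x₀ : EuclideanSpace ℝ (Fin d))
    (α : ℝ) (hα₀ : 0 < α) (hα₁ : α < 1)
    (τ : ℕ) (hτ : 0 < τ)
    (K : ℕ) (hK : 60 * (m : ℝ) * (τ : ℝ) ^ 2 / α ^ 2 ≤ (K : ℝ)) :
    let η : ℝ := OverlapLocalSGD.learningRate L m K
    let X : ℕ → Ω → OverlapLocalSGD.State d m := fun k ω =>
      OverlapLocalSGD.iterate g η α τ x₀ (fun j i => ξ j i ω) k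
    let y : ℕ → Ω → EuclideanSpace ℝ (Fin d) := fun k ω =>
      OverlapLocalSGD.virtualModel α (X k ω)
    let Δ : ℝ := OverlapLocalSGD.objective ℓ D
      (OverlapLocalSGD.virtualModel α (OverlapLocalSGD.initialState m x₀)) - F_inf
    -- `y` follows an SGD recursion with effective step `(1 - α) η`
    (∀ k ω, y (k + 1) ω =
      y k ω - ((1 - α) * η) • ((1 / (m : ℝ)) • ∑ i, g i ((X k ω).x i) (ξ k i ω))) ∧
    -- the expectations are finite, and their average obeys the explicit bound
    (∀ k, Integrable (fun ω => ‖gradient (OverlapLocalSGD.objective ℓ D) (y k ω)‖ ^ 2) P) ∧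
    (1 / (K : ℝ)) * ∑ k ∈ Finset.range K,
        ∫ ω, ‖gradient (OverlapLocalSGD.objective ℓ D) (y k ω)‖ ^ 2 ∂P
      ≤ OverlapLocalSGD.errorBound L Δ σ κ α τ m K ∧
    -- the bound is `O(1/√(mK)) + O(m/K)`, with constants independent of `m` and `K`
    (∃ C₁ C₂ : ℝ, ∀ m' K' : ℕ, 0 < m' → 0 < K' →
      |OverlapLocalSGD.errorBound L Δ σ κ α τ m' K'|
        ≤ C₁ / Real.sqrt ((m' : ℝ) * (K' : ℝ)) + C₂ * (m' : ℝ) / (K' : ℝ)) := by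
  intro η X y Δ
  have hm' : (0 : ℝ) < m := by exact_mod_cast hm
  have hτ' : (0 : ℝ) < τ := by exact_mod_cast hτ
  have hK' : (0 : ℝ) < K := lt_of_lt_of_le (by positivity) hK
  have hK₀ : 0 < K := by exact_mod_cast hK'
  have hη₀ : 0 < η := by
    simp only [η, learningRate]; positivity
  -- As `η ^ 2 * L ^ 2 = m / K`, this is the lower bound on `K` rearranged.
  have hη : 60 * (η ^ 2 * L ^ 2 * (τ / α) ^ 2) ≤ 1 := by
    rw [learningRate_sq hL, div_pow]
    rw [div_le_iff₀ (by positivity)] at hK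
    calc 60 * ((m : ℝ) / K * (τ ^ 2 / α ^ 2)) = 60 * m * τ ^ 2 / (K * α ^ 2) := by
          field_simp
      _ ≤ 1 := (div_le_one (by positivity)).2 hK
  have hgrad := hasGradientAt_objective hdiff
  have hcont : ∀ i, Measurable (gradient (localObjective ℓ D i)) := fun i => by
    refine (LipschitzWith.of_dist_le_mul (K := L.toNNReal) fun x y => ?_).continuous.measurable
    rw [dist_eq_norm, dist_eq_norm, Real.coe_toNNReal L hL.le]
    exact hsmooth i x y
  obtain ⟨hint, hsum⟩ := sum_integral_norm_gradient_sq_le (x₀ := x₀) (F := objective ℓ D) hm hg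
    (fun x => (hgrad x).differentiableAt) (fun x => (hgrad x).gradient) hF_inf hL.le hcont hsmooth
    (κ := κ) (fun x => by
      have h := hdissim x
      rwa [(hgrad x).gradient, one_div, inv_mul_le_iff₀ hm'] at h)
    hunbiased hvar hξ hlaw hindep hα₀ hα₁ hτ hη₀ hη K
  refine ⟨fun k ω => virtualModel_succ g η α τ x₀ _ hm k, hint, ?_,
    exists_abs_errorBound_le L Δ σ κ α τ⟩
  refine le_trans ?_ (average_le_errorBound hL (sub_nonneg.2 (hF_inf _)) hα₀ hα₁ hm hK₀)
  gcongr
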